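/- Write $\omega(p)=|p|$ for $p\in\mathbb R^3$, let $\mathcal H=L^2(\mathbb R^3,(2\omega)^{-1}dp;\mathbb C^3)$ with inner product antilinear in the first argument, and let $\mathcal H_T\subset\mathcal H$ be the closed subspace of transverse functions, $p\cdot h(p)=0$ a.e. Let $\mathcal F=\bigoplus_{n\ge0}\mathcal H_T^{n}$ be the Fock space ($\mathcal H_T^n$ the $n$-fold symmetric tensor power) with vacuum $\Omega_0$ and, on finite-particle vectors, creation and annihilation operators $a^*(h),a(h)$ with $[a(h_1),a^*(h_2)]=(h_1,h_2)$. Let $\mathcal S\subset\mathcal H_T$ be the set of those $h$ such that for every $k\ge0$ there is $C$ with $|h(p)|\le C(1+|p|^2)^{-k}$ a.e. Put $W_{in}(h)=\exp\big(\tfrac{i}{\sqrt2}(a^*(h)+a(h))\big)$, and let $\mathfrak A$ be the $C^*$-algebra of operators on $\mathcal F$ generated by the $W_{in}(h)$, $h\in\mathcal S$, with the state $\omega_{in}(B)=(\Omega_0,B\Omega_0)$. For a trajectory $x:\mathbb R\to\mathbb R^3$ let $$J(p)=-i(2\pi)^{-3/2}\int_{\mathbb R}x'(s)\,e^{i\omega(p)s-ip\cdot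 x(s)}\,ds,\qquad J_T(p)=J(p)-\frac{p\cdot J(p)}{|p|^2}\,p,$$ and for $h\in\mathcal S$ let $(J_T,h)=\int\overline{J_T(p)}\cdot h(p)\,\frac{dp}{2\omega}$, $a^*_{out}(h)=a^*(h)-(J_T,h)$, $a_{out}(h)=a(h)-\overline{(J_T,h)}$ and $W_{out}(h)=\exp\big(\tfrac{i}{\sqrt2}(a^*_{out}(h)+a_{out}(h))\big)$. The out state is $\omega_{out}=\omega_{in}\circ\alpha$, where $\alpha$ is the $*$-automorphism of $\mathfrak A$ with $\alpha(W_{out}(h))=W_{in}(h)$ for all $h\in\mathcal S$. **Proposition.** Let $x:\mathbb R\to\mathbb R^3$ be $C^3$ with $|x'(t)|\le v_0<1$ for all $t$, and suppose $x'$ has compact support. Then $J_T\in\mathcal H_T$; the operators $W_{out}(h)$, $h\in\mathcal S$, lie in $\mathfrak A$ and the automorphism $\alpha$ exists and is unique; and $\omega_{out}$ is the Fock state given by the coherent vector $$\Omega_{J_T}=e^{-\frac12\|J_T\|^2}\sum_{n=0}^\infty\frac1{n!}\,a^*(J_T)^n\,\Omega_0\in\mathcal F,$$ that is, $\omega_{out}(B)=(\Omega_{J_T},B\,\Omega_{J_T})$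 for all $B\in\mathfrak A$. -/

import Mathlib

open MeasureTheory Complex
open scoped TensorProduct ENNReal InnerProductSpace

noncomputable section

namespace PointSource

/-! ### Symmetric Fock space over a complex inner product space -/

/-- A complex Hilbert space, bundled. -/
structure HilbertBundle : Type 1 where
  carrier : Type
  [group : NormedAddCommGroup carrier]
  [innerProduct : InnerProductSpace ℂ carrier]
  [complete : CompleteSpace carrier]

attribute [instance] HilbertBundle.group HilbertBundle.innerProduct HilbertBundle.complete

section Fock

variable (H : Type) [NormedAddCommGroup H] [InnerProductSpace ℂ H]

/-- The `n`-fold Hilbert space tensor power: `ℂ` for `n = 0`, and the completion of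
`H ⊗ H^{⊗ n}`, with `⟪a ⊗ b, c ⊗ d⟫ = ⟪a, c⟫ ⟪b, d⟫`, for `n + 1`. -/
def tensorBundle : ℕ → HilbertBundle
  | 0 => { carrier := ℂ }
  | n + 1 => { carrier := UniformSpace.Completion (H ⊗[ℂ] (tensorBundle n).carrier) }

/-- The Hilbert space `H^{⊗ n}`. -/
abbrev HTensor (n : ℕ) : Type := (tensorBundle H n).carrier

variable {H}

/-- The map `ψ ↦ h ⊗ ψ` from `E` to the Hilbert space tensor product of `H` and `E`. -/
def leftTensor (E : Type) [NormedAddCommGroup E] [InnerProductSpace ℂ E] (h : H) :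
    E →L[ℂ] UniformSpace.Completion (H ⊗[ℂ] E) :=
  LinearMap.mkContinuous
    { toFun := fun ψ => ((h ⊗ₜ[ℂ] ψ : H ⊗[ℂ] E) : UniformSpace.Completion (H ⊗[ℂ] E))
      map_add' := fun ψ φ => by
        rw [TensorProduct.tmul_add, UniformSpace.Completion.coe_add]
      map_smul' := fun c ψ => by
        rw [TensorProduct.tmul_smul, UniformSpace.Completion.coe_smul, RingHom.id_apply] }
    ‖h‖ (fun ψ => by
      simp only [LinearMap.coe_mk, AddHom.coe_mk, UniformSpace.Completion.norm_coe,
        TensorProduct.norm_tmul, le_refl])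

/-- The map `ψ ↦ h ⊗ ψ` from `H^{⊗ n}` to `H^{⊗ (n + 1)}`. -/
def tensorLeft (n : ℕ) (h : H) : HTensor H n →L[ℂ] HTensor H (n + 1) :=
  leftTensor (HTensor H n) h

/-- The pure power `k ⊗ ⋯ ⊗ k` (`n` factors). -/
def purePow (k : H) : (n : ℕ) → HTensor H n
  | 0 => (1 : ℂ)
  | n + 1 => tensorLeft n k (purePow k n)

variable (H)

/-- The `n`-fold symmetric tensor product of `H`: the closed subspace of `H^{⊗ n}` spanned by
the pure powers `k ⊗ ⋯ ⊗ k`; by polarization these span the symmetrized tensors. -/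
def symTensor (n : ℕ) : Submodule ℂ (HTensor H n) :=
  (Submodule.span ℂ (Set.range fun k : H => purePow k n)).topologicalClosure

instance symTensor.instCompleteSpace (n : ℕ) : CompleteSpace (symTensor H n) :=
  inferInstanceAs (CompleteSpace
    (Submodule.span ℂ (Set.range fun k : H => purePow k n)).topologicalClosure)

/-- The `n`-particle space: the `n`-fold symmetric tensor product as a Hilbert space. -/
def NParticle (n : ℕ) : Type := symTensor H n

instance NParticle.instNormedAddCommGroup (n : ℕ) : NormedAddCommGroup (NParticle H n) :=
  inferInstanceAs (NormedAddCommGroup (symTensor H n))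

instance NParticle.instInnerProductSpace (n : ℕ) : InnerProductSpace ℂ (NParticle H n) :=
  inferInstanceAs (InnerProductSpace ℂ (symTensor H n))

instance NParticle.instCompleteSpace (n : ℕ) : CompleteSpace (NParticle H n) :=
  inferInstanceAs (CompleteSpace (symTensor H n))

/-- The inclusion of the symmetric tensors in all tensors. -/
def NParticle.incl (n : ℕ) : NParticle H n →L[ℂ] HTensor H n := (symTensor H n).subtypeL

/-- The orthogonal projection onto the symmetric tensors. -/
def NParticle.proj (n : ℕ) : HTensor H n →L[ℂ] NParticle H n :=
  (symTensor H n).orthogonalProjectionOnto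

/-- The Fock space: the Hilbert space direct sum of the symmetric tensor products. -/
abbrev Fock : Type := lp (fun n : ℕ => NParticle H n) 2

/-- The finite-particle vectors. -/
def finiteParticle : Submodule ℂ (Fock H) where
  carrier := {ψ | {n : ℕ | ψ n ≠ 0}.Finite}
  zero_mem' := by simp
  add_mem' := fun {ψ φ} hψ hφ => (hψ.union hφ).subset fun n hn => by
    by_contra hc
    simp only [Set.mem_union, Set.mem_ofPred_eq, not_or, not_not] at hc
    exact hn (by rw [lp.coeFn_add, Pi.add_apply, hc.1, hc.2, add_zero])
  smul_mem' := fun c ψ hψ => hψ.subset fun n hn hc => hn (by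
    rw [lp.coeFn_smul, Pi.smul_apply, hc, smul_zero])

variable {H}

/-- A finite-particle vector from its components. -/
def mkFinite (f : ∀ n : ℕ, NParticle H n) (hf : {n : ℕ | f n ≠ 0}.Finite) : finiteParticle H :=
  ⟨⟨f, (memℓp_zero hf).of_exponent_ge zero_le⟩, hf⟩

/-- The creation map from `n` to `n + 1` particles: `ψ ↦ √(n + 1) P (h ⊗ ψ)`, with `P` the
orthogonal projection onto the symmetric tensors. -/
def creationStep (n : ℕ) (h : H) : NParticle H n →L[ℂ] NParticle H (n + 1) :=
  ((Real.sqrt (n + 1) : ℝ) : ℂ) •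
    (NParticle.proj H (n + 1)).comp ((tensorLeft n h).comp (NParticle.incl H n))

/-- The components of `a*(h) ψ`. -/
def creationFun (h : H) (f : ∀ n : ℕ, NParticle H n) : ∀ n : ℕ, NParticle H n
  | 0 => 0
  | n + 1 => creationStep n h (f n)

/-- The components of `a(h) ψ`. -/
def annihilationFun (h : H) (f : ∀ n : ℕ, NParticle H n) (n : ℕ) : NParticle H n :=
  ContinuousLinearMap.adjoint (creationStep n h) (f (n + 1))

/-- The creation operator `a*(h)` on the finite-particle vectors; it is linear in `h`. -/
def creation (h : H) : finiteParticle H →ₗ[ℂ] finiteParticle H where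
  toFun ψ := mkFinite (creationFun h fun n => (ψ : Fock H) n)
    ((ψ.2.image Nat.succ).subset (by
      rintro (_ | n) hn
      · exact absurd rfl hn
      · refine ⟨n, fun hz => hn ?_, rfl⟩
        simp only [creationFun, hz, map_zero]))
  map_add' ψ φ := by
    ext1; ext1; funext n
    cases n with
    | zero => exact (add_zero (0 : NParticle H 0)).symm
    | succ n => exact map_add (creationStep n h) ((ψ : Fock H) n) ((φ : Fock H) n)
  map_smul' c ψ := by
    ext1; ext1; funext n
    cases n with
    | zero => exact (smul_zero (A := NParticle H 0) c).symm
    | succ n => exact map_smul (creationStep n h) c ((ψ : Fock H) n)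

/-- The annihilation operator `a(h)` on the finite-particle vectors, the adjoint of `a*(h)`;
it is antilinear in `h`. -/
def annihilation (h : H) : finiteParticle H →ₗ[ℂ] finiteParticle H where
  toFun ψ := mkFinite (annihilationFun h fun n => (ψ : Fock H) n)
    ((ψ.2.image Nat.pred).subset (by
      intro n hn
      refine ⟨n + 1, fun hz => hn ?_, rfl⟩
      simp only [annihilationFun, hz, map_zero]))
  map_add' ψ φ := by
    ext1; ext1; funext n
    exact map_add (ContinuousLinearMap.adjoint (creationStep n h))
      ((ψ : Fock H) (n + 1)) ((φ : Fock H) (n + 1))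
  map_smul' c ψ := by
    ext1; ext1; funext n
    exact map_smul (ContinuousLinearMap.adjoint (creationStep n h)) c ((ψ : Fock H) (n + 1))

variable (H)

/-- The Fock vacuum `(1, 0, 0, …)`. -/
def vacuum : finiteParticle H :=
  mkFinite (fun n => match n with
    | 0 => (⟨purePow (0 : H) 0,
        Submodule.le_topologicalClosure _ (Submodule.subset_span ⟨0, rfl⟩)⟩ : symTensor H 0)
    | _ + 1 => 0)
    ((Set.finite_singleton 0).subset (by
      rintro (_ | n) hn
      · rfl
      · exact absurd rfl hn))

variable {H}

/-- The coherent vector `Ω_J = exp(-‖J‖² / 2) ∑ₙ (1 / n!) a*(J)ⁿ Ω₀`. -/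
def coherentVector (J : H) : Fock H :=
  ((Real.exp (-(1 / 2) * ‖J‖ ^ 2) : ℝ) : ℂ) •
    ∑' n : ℕ, ((n.factorial : ℂ)⁻¹) • ((((creation J) ^ n) (vacuum H) : finiteParticle H) : Fock H)

/-- `U` is a strongly continuous one-parameter unitary group whose generator extends `i A`.
If `A` is essentially self-adjoint on the finite-particle vectors, then `U t = exp(i t A)`,
with the closure of `A` in the exponent, is the only such group. -/
structure IsUnitaryGroup (A : finiteParticle H →ₗ[ℂ] finiteParticle H)
    (U : ℝ → (Fock H →L[ℂ] Fock H)) : Prop where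
  unitary_mem : ∀ t, U t ∈ unitary (Fock H →L[ℂ] Fock H)
  map_zero : U 0 = 1
  map_add : ∀ s t, U (s + t) = U s * U t
  continuous : ∀ ψ : Fock H, Continuous fun t => U t ψ
  hasDerivAt : ∀ ψ : finiteParticle H,
    HasDerivAt (fun t : ℝ => U t (ψ : Fock H)) (I • (A ψ : Fock H)) 0

open Classical in
/-- The unitary operator `exp(i A)` of an operator `A` that is essentially self-adjoint on the
finite-particle vectors. -/
def expI (A : finiteParticle H →ₗ[ℂ] finiteParticle H) : Fock H →L[ℂ] Fock H :=
  if hA : ∃ U : ℝ → (Fock H →L[ℂ] Fock H), IsUnitaryGroup A U then hA.choose 1 else 0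

/-- `2^{-1/2} (b* + b)`, the field built from a creation and an annihilation operator. -/
def fieldOf (b' b : finiteParticle H →ₗ[ℂ] finiteParticle H) :
    finiteParticle H →ₗ[ℂ] finiteParticle H :=
  (((Real.sqrt 2)⁻¹ : ℝ) : ℂ) • (b' + b)

/-- The vector functional `B ↦ (Ω, B Ω)`. -/
def vectorState (Ω : Fock H) (B : Fock H →L[ℂ] Fock H) : ℂ := ⟪Ω, B Ω⟫_ℂ

/-- The C*-algebra of bounded operators on Fock space generated by a set of operators. -/
def generatedAlgebra (S : Set (Fock H →L[ℂ] Fock H)) : StarSubalgebra ℂ (Fock H →L[ℂ] Fock H) :=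
  (StarAlgebra.adjoin ℂ S).topologicalClosure

end Fock

/-! ### The one photon space -/

/-- Physical space, and also momentum space. -/
abbrev R3 : Type := EuclideanSpace ℝ (Fin 3)

/-- The values of the wave functions. -/
abbrev C3 : Type := EuclideanSpace ℂ (Fin 3)

/-- A real vector as a complex vector. -/
def toC3 (v : R3) : C3 := WithLp.toLp 2 fun k => ((v k : ℝ) : ℂ)

/-- The bilinear product `p · w = ∑ₖ pₖ wₖ` of a real and a complex vector. -/
def rdot (p : R3) (w : C3) : ℂ := ∑ k : Fin 3, ((p k : ℝ) : ℂ) * w k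

/-- The measure `(2 ω)⁻¹ dp` on momentum space, with `ω(p) = |p|`. -/
def photonMeasure : Measure R3 :=
  volume.withDensity fun p => ENNReal.ofReal ((2 * ‖p‖)⁻¹)

/-- The one photon space `H_T`: the transverse functions in `L²(ℝ³, (2 ω)⁻¹ dp; ℂ³)`. -/
def photonSpace : Submodule ℂ (Lp C3 2 photonMeasure) where
  carrier := {h | ∀ᵐ p ∂photonMeasure, rdot p (h p) = 0}
  zero_mem' := by
    filter_upwards [Lp.coeFn_zero C3 2 photonMeasure] with p hp
    rw [hp]
    simp [rdot]
  add_mem' := fun {f g} hf hg => by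
    filter_upwards [hf, hg, Lp.coeFn_add f g] with p h1 h2 h3
    rw [h3]
    simp only [rdot] at h1 h2
    simp [rdot, mul_add, Finset.sum_add_distrib, h1, h2]
  smul_mem' := fun c f hf => by
    filter_upwards [hf, Lp.coeFn_smul c f] with p h1 h3
    rw [h3]
    simp only [rdot] at h1
    simp [rdot, mul_left_comm _ c, ← Finset.mul_sum, h1]

/-- The one photon space as a type. -/
def Photon : Type := photonSpace

instance Photon.instNormedAddCommGroup : NormedAddCommGroup Photon :=
  inferInstanceAs (NormedAddCommGroup photonSpace)

instance Photon.instInnerProductSpace : InnerProductSpace ℂ Photon :=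
  inferInstanceAs (InnerProductSpace ℂ photonSpace)

/-- The one photon space as a subspace of `L²(ℝ³, (2 ω)⁻¹ dp; ℂ³)`. -/
def Photon.toLp (h : Photon) : Lp C3 2 photonMeasure := photonSpace.subtype h

/-- The values of a one photon state, as an almost everywhere defined function of `p`. -/
def Photon.toFun (h : Photon) : R3 → C3 := ⇑h.toLp

/-- The transverse part `w - p (p · w) / |p|²` of `w` at momentum `p`. -/
def transverse (p : R3) (w : C3) : C3 := w - (rdot p w / ((‖p‖ ^ 2 : ℝ) : ℂ)) • toC3 p

/-- The rapidly decreasing transverse functions. -/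
def rapid : Set Photon :=
  {h | ∀ k : ℕ, ∃ C : ℝ, ∀ᵐ p ∂photonMeasure, ‖h.toFun p‖ ≤ C * ((1 + ‖p‖ ^ 2) ^ k)⁻¹}

/-! ### The field algebra and the out state of a point source with trajectory `x` -/

/-- `J(p) = -i (2π)^{-3/2} ∫ x'(s) exp(i |p| s - i p · x(s)) ds`. -/
def sourceJ (x : ℝ → R3) (p : R3) : C3 :=
  (-I * (((2 * Real.pi) ^ (-(3 / 2 : ℝ)) : ℝ) : ℂ)) •
    ∫ s : ℝ, Complex.exp (I * ((‖p‖ * s - ⟪p, x s⟫_ℝ : ℝ) : ℂ)) • toC3 (deriv x s)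

/-- The transverse part `J_T(p)`. -/
def sourceJT (x : ℝ → R3) (p : R3) : C3 := transverse p (sourceJ x p)

/-- The pairing `(J_T, h) = ∫ conj (J_T(p)) · h(p) (2 ω)⁻¹ dp`, meaningful for bounded `J_T` and
rapidly decreasing `h` whether or not `J_T` is square integrable. -/
def sourcePairing (x : ℝ → R3) (h : Photon) : ℂ :=
  ∫ p, ⟪sourceJT x p, h.toFun p⟫_ℂ ∂photonMeasure

/-- The out creation operator `a*(h) - (J_T, h)`. -/
def creationOut (x : ℝ → R3) (h : Photon) :
    finiteParticle Photon →ₗ[ℂ] finiteParticle Photon :=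
  creation h - sourcePairing x h • LinearMap.id

/-- The out annihilation operator `a(h) - (h, J_T)`. -/
def annihilationOut (x : ℝ → R3) (h : Photon) :
    finiteParticle Photon →ₗ[ℂ] finiteParticle Photon :=
  annihilation h - (starRingEnd ℂ) (sourcePairing x h) • LinearMap.id

/-- `W_in(h) = exp(i A_in(h))`. -/
def weylIn (h : Photon) : Fock Photon →L[ℂ] Fock Photon :=
  expI (fieldOf (creation h) (annihilation h))

/-- `W_out(h) = exp(i A_out(h))`. -/
def weylOut (x : ℝ → R3) (h : Photon) : Fock Photon →L[ℂ] Fock Photon :=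
  expI (fieldOf (creationOut x h) (annihilationOut x h))

/-- The C*-algebra generated by the operators `W_in(h)`, `h` rapidly decreasing. -/
def fieldAlgebra : StarSubalgebra ℂ (Fock Photon →L[ℂ] Fock Photon) :=
  generatedAlgebra (weylIn '' rapid)

/-- `α` is a *-automorphism of the field algebra with `α (W_out(h)) = W_in(h)` for all `h`; in
particular the field algebra contains the operators `W_out(h)`. -/
def IsOutAutomorphism (x : ℝ → R3) (α : fieldAlgebra ≃⋆ₐ[ℂ] fieldAlgebra) : Prop :=
  ∀ h ∈ rapid, ∃ hW : weylOut x h ∈ fieldAlgebra,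
    (α ⟨weylOut x h, hW⟩ : Fock Photon →L[ℂ] Fock Photon) = weylIn h

/-- The in state on the field algebra: the Fock vacuum. -/
def stateIn (B : fieldAlgebra) : ℂ :=
  vectorState (vacuum Photon : Fock Photon) (B : Fock Photon →L[ℂ] Fock Photon)

/-- The state `ω_in ∘ α`; it is the out state when `α` is the out automorphism. -/
def stateComp (α : fieldAlgebra ≃⋆ₐ[ℂ] fieldAlgebra) (B : fieldAlgebra) : ℂ := stateIn (α B)

end PointSource

end

/-! The out field differs from the in field by a number: the pairing and its conjugate enter
together, so `fieldOf_out` gives A_out(h) = A_in(h) - √2 Re (J_T, h), and W_out(h) is W_in(h) times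
the phase exp(-i√2 Re (J_T, h)). The automorphism α therefore has to multiply each W_in(h) by the
opposite phase. If J_T is a one photon state J, such a map is conjugation with a Weyl operator: put
f = -i√2 J and D = exp(iΦ(f)). The Weyl relation D* W(h) D = exp(-i Im (h, f)) W(h) has exactly the
required phase, and D maps the vacuum to Ω_J because iΦ(f) = a*(J) - a(J). Hence α(B) = D* B D and
ω_out(B) = (DΩ₀, B DΩ₀). The vector J need not be rapidly decreasing, so D is not assumed to lie in
the algebra; conjugation preserves the algebra because it multiplies each generator by a phase.
Uniqueness holds because the generators determine a continuous *-homomorphism.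

That J_T is square integrable is a nonstationary phase estimate. The phase |p|s - p·x(s) has
derivative at least |p|(1 - v₀), so two integrations by parts give |J_T(p)| ≤ C(1 + |p|²)⁻¹
(`exists_norm_sourceJT_le`); boundedness near p = 0 comes from the integrability of x'. In three
dimensions the square of this bound is integrable against dp/(2|p|).

The operator theory rests on entire vectors. On finite-particle vectors ‖Φ(h)ᵏψ‖ grows roughly like
√(k!), so the exponential series converges and defines a unitary group. Conversely, any unitary
group whose generator extends iΦ(h) agrees with the series at time 1 (`IsEntire.group_one_apply`),
so `expI` does not depend on the group it chooses. The tool is `norm_sub_group_apply_le`: a curve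
that solves g' = iAg up to a small defect stays close to the orbit of its initial value. Applied to
truncated series, it yields both this uniqueness and the formula for DΩ₀. The Weyl relation follows
from uniqueness, by comparing the conjugated group with the group of Φ(h) plus a constant. -/

noncomputable section

namespace PointSource

/-! ### Exponential series on entire vectors of a symmetric operator -/

section EntireVectors

open Filter Topology

variable {E : Type*} [NormedAddCommGroup E] [InnerProductSpace ℂ E] {D : Submodule ℂ E}

theorem sum_antidiagonal_pow_div_factorial {K : Type*} [Field K] [CharZero K] (x y : K) (n : ℕ) :
    ∑ m ∈ Finset.HasAntidiagonal.antidiagonal n,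
        x ^ m.1 / (m.1.factorial : K) * (y ^ m.2 / (m.2.factorial : K)) =
      (x + y) ^ n / (n.factorial : K) := by
  rw [(Commute.all x y).add_pow', Finset.sum_div]
  refine Finset.sum_congr rfl fun m hm => ?_
  obtain ⟨i, j⟩ := m
  obtain rfl : i + j = n := by simpa using hm
  have h : ((i + j).choose i : K) * i.factorial * j.factorial = (i + j).factorial := by
    rw [Nat.choose_symm_add]
    exact_mod_cast Nat.add_choose_mul_factorial_mul_factorial i j
  have hi : (i.factorial : K) ≠ 0 := by exact_mod_cast i.factorial_ne_zero
  have hj : (j.factorial : K) ≠ 0 := by exact_mod_cast j.factorial_ne_zero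
  have hij : ((i + j).factorial : K) ≠ 0 := by exact_mod_cast (i + j).factorial_ne_zero
  rw [nsmul_eq_mul]
  field_simp
  rw [← h]
  ring

/-- Every vector of the domain is an entire vector of `A`. -/
def IsEntire (A : D →ₗ[ℂ] D) : Prop :=
  ∀ (ψ : D) (r : ℝ), Summable fun k : ℕ => r ^ k / (k.factorial : ℝ) * ‖(A ^ k) ψ‖

/-- The exponential series `∑ₖ (z ^ k / k!) A ^ k ψ`. -/
def expVec (A : D →ₗ[ℂ] D) (z : ℂ) (ψ : D) : E :=
  ∑' k : ℕ, (z ^ k / (k.factorial : ℂ)) • (((A ^ k) ψ : D) : E)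

theorem norm_pow_div_factorial (z : ℂ) (k : ℕ) :
    ‖z ^ k / (k.factorial : ℂ)‖ = ‖z‖ ^ k / (k.factorial : ℝ) := by
  simp

variable {A : D →ₗ[ℂ] D}

theorem IsEntire.summable_norm (hA : IsEntire A) (z : ℂ) (ψ : D) :
    Summable fun k : ℕ => ‖(z ^ k / (k.factorial : ℂ)) • (((A ^ k) ψ : D) : E)‖ := by
  refine (hA ψ ‖z‖).congr fun k => ?_
  rw [norm_smul, norm_pow_div_factorial]
  rfl

theorem expVec_zero (ψ : D) : expVec A 0 ψ = ψ := by
  rw [expVec, tsum_eq_single 0 (fun k hk => by simp [hk])]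
  simp

theorem inner_pow_left (hsym : ∀ ψ φ : D, ⟪(A ψ : E), (φ : E)⟫_ℂ = ⟪(ψ : E), (A φ : E)⟫_ℂ)
    (k : ℕ) (ψ φ : D) :
    ⟪(((A ^ k) ψ : D) : E), (φ : E)⟫_ℂ = ⟪(ψ : E), (((A ^ k) φ : D) : E)⟫_ℂ := by
  induction k generalizing ψ φ with
  | zero => rfl
  | succ k ih =>
    rw [pow_succ, Module.End.mul_apply, ih, hsym, ← Module.End.mul_apply, ← pow_succ', pow_succ]

/-- All terms are nonnegative, so they may be grouped along antidiagonals; by the binomial theorem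
the groups form the exponential series at radius r + s. This is what permits the rearrangement in
`hasSum_expVec_add`. -/
theorem IsEntire.summable_prod (hA : IsEntire A) (r s : ℝ) (hr : 0 ≤ r) (hs : 0 ≤ s) (ψ : D) :
    Summable fun m : ℕ × ℕ => r ^ m.1 / (m.1.factorial : ℝ) * (s ^ m.2 / (m.2.factorial : ℝ)) *
      ‖(A ^ (m.1 + m.2)) ψ‖ := by
  rw [← Finset.HasAntidiagonal.sigmaAntidiagonalEquivProd.summable_iff,
    summable_sigma_of_nonneg fun _ => by
      simp only [Function.comp]; positivity]
  refine ⟨fun n => (hasSum_fintype _).summable, ?_⟩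
  refine (hA ψ (r + s)).congr fun n => ?_
  rw [tsum_fintype, ← sum_antidiagonal_pow_div_factorial, Finset.sum_mul,
    ← Finset.sum_coe_sort (Finset.HasAntidiagonal.antidiagonal n)]
  refine Finset.sum_congr rfl fun m _ => ?_
  have := Finset.HasAntidiagonal.mem_antidiagonal.1 m.2
  simp [Finset.HasAntidiagonal.sigmaAntidiagonalEquivProd, this]

variable [CompleteSpace E]

theorem IsEntire.hasSum_expVec (hA : IsEntire A) (z : ℂ) (ψ : D) :
    HasSum (fun k : ℕ => (z ^ k / (k.factorial : ℂ)) • (((A ^ k) ψ : D) : E)) (expVec A z ψ) :=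
  (hA.summable_norm z ψ).of_norm.hasSum

/-- The group law exp(zA) exp(wA) = exp((z + w)A). The vector `expVec A w ψ` need not lie in the
domain of A, so the powers belonging to z act on ψ before the inner exponential is formed. -/
theorem IsEntire.hasSum_expVec_add (hA : IsEntire A) (z w : ℂ) (ψ : D) :
    HasSum (fun k : ℕ => (z ^ k / (k.factorial : ℂ)) • expVec A w ((A ^ k) ψ))
      (expVec A (z + w) ψ) := by
  let F : ℕ × ℕ → E := fun m =>
    (z ^ m.1 / (m.1.factorial : ℂ) * (w ^ m.2 / (m.2.factorial : ℂ))) •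
      (((A ^ (m.1 + m.2)) ψ : D) : E)
  have hF : Summable F := by
    refine Summable.of_norm ((hA.summable_prod ‖z‖ ‖w‖ (norm_nonneg _) (norm_nonneg _) ψ).congr
      fun m => ?_)
    rw [norm_smul, norm_mul, norm_pow_div_factorial, norm_pow_div_factorial]
    rfl
  have h1 : HasSum (fun k : ℕ => (z ^ k / (k.factorial : ℂ)) • expVec A w ((A ^ k) ψ))
      (∑' m, F m) := by
    refine hF.hasSum.prod_fiberwise fun k => ?_
    refine ((hA.hasSum_expVec w ((A ^ k) ψ)).const_smul (z ^ k / (k.factorial : ℂ))).congr_fun ?_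
    intro j
    simp only [F, smul_smul]
    rw [add_comm k j, pow_add, Module.End.mul_apply]
  have h2 : HasSum (fun n : ℕ => ((z + w) ^ n / (n.factorial : ℂ)) • (((A ^ n) ψ : D) : E))
      (∑' m, F m) := by
    have h3 := (Finset.HasAntidiagonal.sigmaAntidiagonalEquivProd (A := ℕ)).hasSum_iff.2 hF.hasSum
    refine (h3.sigma fun n => hasSum_fintype _).congr_fun fun n => ?_
    rw [← sum_antidiagonal_pow_div_factorial, Finset.sum_smul,
      ← Finset.sum_coe_sort (Finset.HasAntidiagonal.antidiagonal n)]
    refine Finset.sum_congr rfl fun m _ => ?_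
    have := Finset.HasAntidiagonal.mem_antidiagonal.1 m.2
    simp [F, Finset.HasAntidiagonal.sigmaAntidiagonalEquivProd, this]
  rwa [(hA.hasSum_expVec (z + w) ψ).unique h2]

theorem IsEntire.expVec_add_apply (hA : IsEntire A) (z : ℂ) (ψ φ : D) :
    expVec A z (ψ + φ) = expVec A z ψ + expVec A z φ := by
  refine (hA.hasSum_expVec z (ψ + φ)).unique
    (((hA.hasSum_expVec z ψ).add (hA.hasSum_expVec z φ)).congr_fun fun k => ?_)
  rw [map_add, Submodule.coe_add, smul_add]

theorem IsEntire.expVec_smul_apply (hA : IsEntire A) (z c : ℂ) (ψ : D) :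
    expVec A z (c • ψ) = c • expVec A z ψ := by
  refine (hA.hasSum_expVec z (c • ψ)).unique
    (((hA.hasSum_expVec z ψ).const_smul c).congr_fun fun k => ?_)
  rw [map_smul, Submodule.coe_smul, smul_comm]

theorem IsEntire.inner_expVec_left (hA : IsEntire A)
    (hsym : ∀ ψ φ : D, ⟪(A ψ : E), (φ : E)⟫_ℂ = ⟪(ψ : E), (A φ : E)⟫_ℂ) (z : ℂ) (ψ φ : D) :
    ⟪expVec A z ψ, (φ : E)⟫_ℂ = ⟪(ψ : E), expVec A ((starRingEnd ℂ) z) φ⟫_ℂ := by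
  have h1 : HasSum (fun k : ℕ => ⟪(z ^ k / (k.factorial : ℂ)) • (((A ^ k) ψ : D) : E), (φ : E)⟫_ℂ)
      ⟪expVec A z ψ, (φ : E)⟫_ℂ := by
    have := ((innerSL ℂ (φ : E)).hasSum (hA.hasSum_expVec z ψ)).star
    simpa only [innerSL_apply_apply, RCLike.star_def, inner_conj_symm] using this
  refine h1.unique (((innerSL ℂ (ψ : E)).hasSum
    (hA.hasSum_expVec ((starRingEnd ℂ) z) φ)).congr_fun fun k => ?_)
  simp only [inner_smul_left, inner_pow_left hsym, innerSL_apply_apply, inner_smul_right, map_div₀,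
    map_pow, map_natCast]

theorem IsEntire.inner_expVec (hA : IsEntire A)
    (hsym : ∀ ψ φ : D, ⟪(A ψ : E), (φ : E)⟫_ℂ = ⟪(ψ : E), (A φ : E)⟫_ℂ) (t : ℝ) (ψ φ : D) :
    ⟪expVec A (I * t) ψ, expVec A (I * t) φ⟫_ℂ = ⟪(ψ : E), (φ : E)⟫_ℂ := by
  have h0 := (innerSL ℂ (ψ : E)).hasSum (hA.hasSum_expVec_add (I * t) (-(I * t)) φ)
  rw [add_neg_cancel, expVec_zero] at h0
  refine (((innerSL ℂ (expVec A (I * t) ψ)).hasSum (hA.hasSum_expVec (I * t) φ))).unique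
    (h0.congr_fun fun k => ?_)
  simp only [innerSL_apply_apply, inner_smul_right, hA.inner_expVec_left hsym, map_mul, conj_I,
    conj_ofReal, neg_mul]

theorem IsEntire.norm_expVec (hA : IsEntire A)
    (hsym : ∀ ψ φ : D, ⟪(A ψ : E), (φ : E)⟫_ℂ = ⟪(ψ : E), (A φ : E)⟫_ℂ) (t : ℝ) (ψ : D) :
    ‖expVec A (I * t) ψ‖ = ‖(ψ : E)‖ := by
  rw [@norm_eq_sqrt_re_inner ℂ, hA.inner_expVec hsym, ← @norm_eq_sqrt_re_inner ℂ]

/-- The exponential series as a function of time has derivative `i A ψ` at `0`. -/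
theorem IsEntire.hasDerivAt_expVec (hA : IsEntire A) (ψ : D) :
    HasDerivAt (fun t : ℝ => expVec A (I * t) ψ) (I • (A ψ : E)) 0 := by
  -- For |t| < 1 the derivative of the k-th term is at most k/k! ‖Aᵏψ‖, and k ≤ 2ᵏ places it under
  -- the exponential series at radius 2.
  have hu := hA ψ 2
  have key := hasDerivAt_tsum_of_isPreconnected (𝕜 := ℝ)
    (g := fun (k : ℕ) (t : ℝ) => ((I * t) ^ k / (k.factorial : ℂ)) • (((A ^ k) ψ : D) : E))
    (g' := fun (k : ℕ) (t : ℝ) =>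
      (((k : ℂ) * (I * t) ^ (k - 1) * I) / (k.factorial : ℂ)) • (((A ^ k) ψ : D) : E))
    (t := Set.Ioo (-1 : ℝ) 1) (y₀ := 0) (y := 0) hu isOpen_Ioo isPreconnected_Ioo ?_ ?_ (by simp) ?_
    (by simp)
  · refine key.congr_deriv ?_
    rw [tsum_eq_single 1]
    · simp
    · intro k hk
      rcases k with _ | _ | k
      · simp
      · exact absurd rfl hk
      · simp
  · intro k t _
    refine HasDerivAt.smul_const ?_ _
    refine HasDerivAt.div_const ?_ _
    have := (((hasDerivAt_id t).ofReal_comp).const_mul I).pow k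
    simpa using! this
  · intro k t ht
    rw [norm_smul]
    refine mul_le_mul_of_nonneg_right ?_ (norm_nonneg _)
    have ht1 : ‖I * (t : ℂ)‖ ≤ 1 := by
      simp only [norm_mul, norm_I, one_mul, norm_real, Real.norm_eq_abs]
      exact abs_le.2 ⟨ht.1.le, ht.2.le⟩
    rw [norm_div, norm_mul, norm_mul, norm_I, norm_pow, mul_one]
    simp only [Complex.norm_natCast]
    gcongr
    calc (k : ℝ) * ‖I * (t : ℂ)‖ ^ (k - 1) ≤ k * 1 := by
          gcongr; exact pow_le_one₀ (norm_nonneg _) ht1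
      _ ≤ 2 ^ k := by
          rw [mul_one]; exact_mod_cast (Nat.lt_two_pow_self).le
  · exact (hA.hasSum_expVec _ ψ).summable

end EntireVectors

/-! ### Unitary groups generated by symmetric operators, and their uniqueness -/

section UnitaryGroups

open Filter Topology

variable {E : Type*} [NormedAddCommGroup E] [InnerProductSpace ℂ E]
  {D : Submodule ℂ E} {A : D →ₗ[ℂ] D}

/-- A group of isometries that is differentiable at time `0` on a dense set is strongly
continuous. -/
theorem continuous_apply_of_dense (hD : Dense (D : Set E)) {U : ℝ → E →L[ℂ] E}
    (hnorm : ∀ t ψ, ‖U t ψ‖ = ‖ψ‖) (hadd : ∀ s t, U (s + t) = U s * U t)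
    (hcont : ∀ ψ : D, ContinuousAt (fun t => U t (ψ : E)) 0) (ψ : E) :
    Continuous fun t => U t ψ := by
  have hc : ∀ φ : D, Continuous fun t => U t (φ : E) := by
    intro φ
    rw [continuous_iff_continuousAt]
    intro t
    have h1 : ContinuousAt (fun s => U t (U (s - t) (φ : E))) t := by
      refine (U t).continuous.continuousAt.comp ?_
      have h2 : ContinuousAt (fun s => U s (φ : E)) (t - t) := by
        rw [sub_self]; exact hcont φ
      exact ContinuousAt.comp (g := fun s => U s (φ : E)) (f := fun s => s - t) h2 (by fun_prop)
    refine h1.congr (Eventually.of_forall fun s => ?_)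
    simp only
    rw [← mul_apply_eq_comp, ← hadd, add_sub_cancel]
  refine continuous_of_uniform_approx_of_continuous fun u hu => ?_
  obtain ⟨ε, hε, hεu⟩ := Metric.mem_uniformity_dist.1 hu
  obtain ⟨φ, hφ, hφε⟩ := Metric.dense_iff.1 hD ψ ε hε
  refine ⟨fun t => U t φ, hc ⟨φ, hφε⟩, fun t => hεu ?_⟩
  rw [dist_eq_norm, ← map_sub, hnorm, ← dist_eq_norm, dist_comm]
  exact hφ

/-- If the generator of a strongly continuous group of isometries maps `e N` to `i a N`, with
`e N → φ` and `a N → χ`, then it maps `φ` to `i χ`. -/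
theorem hasDerivAt_apply_of_tendsto {U : ℝ → E →L[ℂ] E}
    (hnorm : ∀ t ψ, ‖U t ψ‖ = ‖ψ‖) {e a : ℕ → E} {φ χ : E}
    (hderiv : ∀ N t, HasDerivAt (fun t => U t (e N)) (I • U t (a N)) t)
    (he : Tendsto e atTop (𝓝 φ)) (ha : Tendsto a atTop (𝓝 χ)) (t : ℝ) :
    HasDerivAt (fun t => U t φ) (I • U t χ) t := by
  refine hasDerivAt_of_tendstoUniformly (l := atTop) (f := fun N t => U t (e N))
    (f' := fun N t => I • U t (a N)) (g' := fun t => I • U t χ) ?_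
    (Eventually.of_forall hderiv) (fun s => ((U s).continuous.tendsto _).comp he) t
  rw [Metric.tendstoUniformly_iff]
  intro ε hε
  filter_upwards [(Metric.tendsto_nhds.1 ha) ε hε] with N hN s
  rw [dist_eq_norm, ← smul_sub, ← map_sub, norm_smul, hnorm, norm_I, one_mul, ← dist_eq_norm,
    dist_comm]
  exact hN

theorem hasDerivAt_group_apply {U : ℝ → E →L[ℂ] E} (hadd : ∀ s t, U (s + t) = U s * U t)
    {φ χ : E} (h0 : HasDerivAt (fun t => U t φ) χ 0) (t : ℝ) :
    HasDerivAt (fun t => U t φ) (U t χ) t := by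
  have h1 : HasDerivAt (fun s => U t (U (s - t) φ)) (U t χ) t := by
    have h2 : HasDerivAt (fun s => U (s - t) φ) χ t := by
      have h3 : HasDerivAt (fun s => U s φ) χ (t - t) := by rwa [sub_self]
      exact h3.comp_sub_const t t
    exact ((U t).restrictScalars ℝ).hasFDerivAt.comp_hasDerivAt t h2
  refine h1.congr_of_eventuallyEq (Eventually.of_forall fun s => ?_)
  simp only
  rw [← mul_apply_eq_comp, ← hadd, add_sub_cancel]

/-- A curve in the domain that solves the equation `g' = i A g` up to an error of norm at most `ε`
stays within `ε` of the orbit of the group on the unit time interval. -/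
theorem norm_sub_group_apply_le {U : ℝ → E →L[ℂ] E} (hnorm : ∀ t ψ, ‖U t ψ‖ = ‖ψ‖)
    (hzero : U 0 = 1) (hadd : ∀ s t, U (s + t) = U s * U t)
    (hderiv : ∀ ψ : D, HasDerivAt (fun t => U t (ψ : E)) (I • (A ψ : E)) 0)
    {c c' : ℕ → ℝ → ℂ} (hc : ∀ k s, HasDerivAt (c k) (c' k s) s) (e : ℕ → D) (N : ℕ) {ε : ℝ}
    (hε : ∀ s ∈ Set.Icc (0 : ℝ) 1,
      ‖∑ k ∈ Finset.range N, (c' k s • (e k : E) - (c k s * I) • (A (e k) : E))‖ ≤ ε) :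
    ‖∑ k ∈ Finset.range N, c k 1 • (e k : E) - U 1 (∑ k ∈ Finset.range N, c k 0 • (e k : E))‖
      ≤ ε := by
  -- For a curve g, the derivative of U(-s) g(s) is U(-s) applied to the defect g' - iAg. Since U is
  -- isometric, the mean value inequality on [0, 1] bounds the displacement by ε, and applying U(1)
  -- gives the claim.
  have hd : ∀ s : ℝ, HasDerivAt
      (fun s => ∑ k ∈ Finset.range N, c k s • U (-s) (e k : E))
      (U (-s) (∑ k ∈ Finset.range N, (c' k s • (e k : E) - (c k s * I) • (A (e k) : E)))) s := by
    intro s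
    have h1 : HasDerivAt
        (fun s => ∑ k ∈ Finset.range N, c k s • U (-s) (e k : E))
        (∑ k ∈ Finset.range N, (c k s • -(U (-s) (I • (A (e k) : E))) + c' k s • U (-s) (e k : E)))
        s := by
      refine HasDerivAt.fun_sum fun k _ => (hc k s).fun_smul ?_
      have := (hasDerivAt_group_apply hadd (hderiv (e k)) (-s)).scomp s (hasDerivAt_neg s)
      simpa using! this
    refine h1.congr_deriv ?_
    rw [map_sum]
    refine Finset.sum_congr rfl fun k _ => ?_
    simp only [map_sub, map_smul, smul_neg, smul_smul]
    abel
  have key := norm_image_sub_le_of_norm_deriv_le_segment_01'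
    (fun s _ => (hd s).hasDerivWithinAt) (C := ε) fun s hs => by
      rw [hnorm]; exact hε s ⟨hs.1, hs.2.le⟩
  rw [← hnorm 1] at key
  convert key using 2
  rw [map_sub]
  simp only [neg_zero, hzero, one_apply_eq_self]
  congr 1
  simp only [map_sum, map_smul]
  refine Finset.sum_congr rfl fun k _ => ?_
  rw [← mul_apply_eq_comp, ← hadd, add_neg_cancel, hzero,
    one_apply_eq_self]

variable [CompleteSpace E]

/-- The exponential series of a symmetric operator, extended to the whole space by continuity. -/
def expCLM (A : D →ₗ[ℂ] D) (hA : IsEntire A) (t : ℝ) : E →L[ℂ] E :=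
  LinearMap.extendOfNorm
    ({ toFun := expVec A (I * t)
       map_add' := hA.expVec_add_apply (I * t)
       map_smul' := hA.expVec_smul_apply (I * t) } : D →ₗ[ℂ] E) D.subtype

theorem expCLM_apply (hD : Dense (D : Set E)) (hA : IsEntire A)
    (hsym : ∀ ψ φ : D, ⟪(A ψ : E), (φ : E)⟫_ℂ = ⟪(ψ : E), (A φ : E)⟫_ℂ) (t : ℝ) (ψ : D) :
    expCLM A hA t (ψ : E) = expVec A (I * t) ψ :=
  LinearMap.extendOfNorm_eq (e := D.subtype) hD.denseRange_val
    ⟨1, fun φ => by rw [one_mul]; exact (hA.norm_expVec hsym t φ).le⟩ ψ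

theorem norm_expCLM (hD : Dense (D : Set E)) (hA : IsEntire A)
    (hsym : ∀ ψ φ : D, ⟪(A ψ : E), (φ : E)⟫_ℂ = ⟪(ψ : E), (A φ : E)⟫_ℂ) (t : ℝ) (ψ : E) :
    ‖expCLM A hA t ψ‖ = ‖ψ‖ := by
  have : (fun ψ : E => ‖expCLM A hA t ψ‖) = fun ψ => ‖ψ‖ :=
    Continuous.ext_on hD (by fun_prop) (by fun_prop) fun ψ hψ => by
      have := expCLM_apply hD hA hsym t ⟨ψ, hψ⟩
      simp only at this
      simp only [this, hA.norm_expVec hsym]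
  exact congrFun this ψ

theorem expCLM_add (hD : Dense (D : Set E)) (hA : IsEntire A)
    (hsym : ∀ ψ φ : D, ⟪(A ψ : E), (φ : E)⟫_ℂ = ⟪(ψ : E), (A φ : E)⟫_ℂ) (s t : ℝ) :
    expCLM A hA (s + t) = expCLM A hA s * expCLM A hA t := by
  refine ContinuousLinearMap.coeFn_injective (Continuous.ext_on hD
    (expCLM A hA (s + t)).continuous (expCLM A hA s * expCLM A hA t).continuous fun ψ hψ => ?_)
  lift ψ to D using hψ
  rw [mul_apply_eq_comp, expCLM_apply hD hA hsym, expCLM_apply hD hA hsym]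
  -- The inner exponential may leave the domain; the bounded outer operator is applied to its
  -- partial sums instead.
  have h1 := (expCLM A hA s).hasSum (hA.hasSum_expVec (I * t) ψ)
  simp only [map_smul, expCLM_apply hD hA hsym] at h1
  rw [h1.unique (hA.hasSum_expVec_add (I * t) (I * s) ψ)]
  congr 1
  push_cast
  ring

theorem expCLM_zero (hD : Dense (D : Set E)) (hA : IsEntire A)
    (hsym : ∀ ψ φ : D, ⟪(A ψ : E), (φ : E)⟫_ℂ = ⟪(ψ : E), (A φ : E)⟫_ℂ) :
    expCLM A hA 0 = 1 := by
  refine ContinuousLinearMap.coeFn_injective (Continuous.ext_on hD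
    (expCLM A hA 0).continuous (1 : E →L[ℂ] E).continuous fun ψ hψ => ?_)
  lift ψ to D using hψ
  rw [expCLM_apply hD hA hsym, ofReal_zero, mul_zero, expVec_zero]
  rfl

theorem mem_unitary_of_norm_of_rightInverse {U V : E →L[ℂ] E} (hU : ∀ ψ, ‖U ψ‖ = ‖ψ‖)
    (hV : U * V = 1) : U ∈ unitary (E →L[ℂ] E) := by
  have h1 : star U * U = 1 := (ContinuousLinearMap.norm_map_iff_adjoint_comp_self U).1 hU
  have h2 : star U = V := by
    calc star U = star U * (U * V) := by rw [hV, mul_one]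
      _ = V := by rw [← mul_assoc, h1, one_mul]
  exact Unitary.mem_iff.2 ⟨h1, by rw [h2, hV]⟩

theorem expCLM_mem_unitary (hD : Dense (D : Set E)) (hA : IsEntire A)
    (hsym : ∀ ψ φ : D, ⟪(A ψ : E), (φ : E)⟫_ℂ = ⟪(ψ : E), (A φ : E)⟫_ℂ) (t : ℝ) :
    expCLM A hA t ∈ unitary (E →L[ℂ] E) :=
  mem_unitary_of_norm_of_rightInverse (norm_expCLM hD hA hsym t) (V := expCLM A hA (-t)) (by
    rw [← expCLM_add hD hA hsym, add_neg_cancel, expCLM_zero hD hA hsym])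

theorem hasDerivAt_expCLM (hD : Dense (D : Set E)) (hA : IsEntire A)
    (hsym : ∀ ψ φ : D, ⟪(A ψ : E), (φ : E)⟫_ℂ = ⟪(ψ : E), (A φ : E)⟫_ℂ) (ψ : D) :
    HasDerivAt (fun t : ℝ => expCLM A hA t (ψ : E)) (I • (A ψ : E)) 0 := by
  simpa only [expCLM_apply hD hA hsym] using hA.hasDerivAt_expVec ψ

/-- On entire vectors the group at time `1` is given by the exponential series. -/
theorem IsEntire.group_one_apply (hA : IsEntire A) {U : ℝ → E →L[ℂ] E}
    (hnorm : ∀ t ψ, ‖U t ψ‖ = ‖ψ‖) (hzero : U 0 = 1) (hadd : ∀ s t, U (s + t) = U s * U t)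
    (hderiv : ∀ ψ : D, HasDerivAt (fun t => U t (ψ : E)) (I • (A ψ : E)) 0) (ψ : D) :
    U 1 (ψ : E) = expVec A I ψ := by
  have hbound : ∀ N : ℕ, ‖∑ k ∈ Finset.range (N + 1),
      (I ^ k / (k.factorial : ℂ)) • (((A ^ k) ψ : D) : E) - U 1 (ψ : E)‖ ≤
        1 ^ N / (N.factorial : ℝ) * ‖(A ^ (N + 1)) ψ‖ := by
    intro N
    have := norm_sub_group_apply_le (A := A) hnorm hzero hadd hderiv
      (c := fun k s => (I * s) ^ k / (k.factorial : ℂ))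
      (c' := fun k s => ((k : ℂ) * (I * s) ^ (k - 1) * I) / (k.factorial : ℂ))
      (fun k s => by
        refine HasDerivAt.div_const ?_ _
        have := (((hasDerivAt_id s).ofReal_comp).const_mul I).pow k
        simpa using! this)
      (fun k => (A ^ k) ψ) (N + 1) (ε := 1 ^ N / (N.factorial : ℝ) * ‖(A ^ (N + 1)) ψ‖) ?_
    · simp only [ofReal_one, mul_one, ofReal_zero, mul_zero] at this
      rw [Finset.sum_eq_single_of_mem (s := Finset.range (N + 1))
        (f := fun k => ((0 : ℂ) ^ k / (k.factorial : ℂ)) • (((A ^ k) ψ : D) : E)) 0 (by simp)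
        (fun k _ hk => by simp [hk])] at this
      simpa using! this
    · intro s hs
      -- The defect of the truncated exponential series telescopes to its last term.
      have hsum : ∀ M : ℕ, ∑ k ∈ Finset.range (M + 1),
          ((((k : ℂ) * (I * s) ^ (k - 1) * I) / (k.factorial : ℂ)) • (((A ^ k) ψ : D) : E) -
            ((I * s) ^ k / (k.factorial : ℂ) * I) • ((A ((A ^ k) ψ) : D) : E)) =
          -(((I * s) ^ M / (M.factorial : ℂ) * I) • (((A ^ (M + 1)) ψ : D) : E)) := by
        intro M
        induction M with
        | zero => simp
        | succ M ih =>
          rw [Finset.sum_range_succ, ih, pow_succ' A (M + 1), Module.End.mul_apply]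
          have : (((M + 1 : ℕ) : ℂ) * (I * s) ^ (M + 1 - 1) * I) / ((M + 1).factorial : ℂ) =
              (I * s) ^ M / (M.factorial : ℂ) * I := by
            rw [Nat.factorial_succ, Nat.cast_mul, Nat.add_sub_cancel]
            have h1 : ((M + 1 : ℕ) : ℂ) ≠ 0 := by exact_mod_cast M.succ_ne_zero
            have h2 : (M.factorial : ℂ) ≠ 0 := by exact_mod_cast M.factorial_ne_zero
            field_simp
          rw [this]
          abel
      rw [hsum N, norm_neg, norm_smul, norm_mul, norm_I, mul_one, norm_pow_div_factorial]
      have h1 : ‖I * (s : ℂ)‖ ≤ 1 := by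
        simp only [norm_mul, norm_I, one_mul, norm_real, Real.norm_eq_abs]
        exact abs_le.2 ⟨by linarith [hs.1], hs.2⟩
      change _ * ‖(A ^ (N + 1)) ψ‖ ≤ _
      gcongr
  have hlim : Tendsto (fun N : ℕ => (1 : ℝ) ^ N / (N.factorial : ℝ) * ‖(A ^ (N + 1)) ψ‖) atTop
      (𝓝 0) := by
    -- The bounds are the terms of the exponential series of Aψ at radius 1.
    have := (hA (A ψ) 1).tendsto_atTop_zero
    simpa only [pow_succ, Module.End.mul_apply] using this
  have h1 := (tendsto_add_atTop_iff_nat 1).2 (hA.hasSum_expVec I ψ).tendsto_sum_nat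
  have h2 : Tendsto (fun N => ∑ k ∈ Finset.range (N + 1),
      (I ^ k / (k.factorial : ℂ)) • (((A ^ k) ψ : D) : E)) atTop (𝓝 (U 1 (ψ : E))) := by
    rw [tendsto_iff_norm_sub_tendsto_zero]
    exact squeeze_zero (fun _ => norm_nonneg _) hbound hlim
  exact tendsto_nhds_unique h2 h1

end UnitaryGroups

/-! ### Pure powers and the commutation relations on n-particle spaces -/

section FockSpace

open Filter Topology

variable {H : Type} [NormedAddCommGroup H] [InnerProductSpace ℂ H]

theorem inner_tensorLeft (n : ℕ) (h k : H) (ψ φ : HTensor H n) :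
    ⟪tensorLeft n h ψ, tensorLeft n k φ⟫_ℂ = ⟪h, k⟫_ℂ * ⟪ψ, φ⟫_ℂ :=
  (UniformSpace.Completion.inner_coe _ _).trans (TensorProduct.inner_tmul (𝕜 := ℂ) h k ψ φ)

theorem norm_tensorLeft (n : ℕ) (h : H) (ψ : HTensor H n) : ‖tensorLeft n h ψ‖ = ‖h‖ * ‖ψ‖ :=
  (UniformSpace.Completion.norm_coe _).trans (TensorProduct.norm_tmul h ψ)

theorem tensorLeft_add (n : ℕ) (h k : H) (ψ : HTensor H n) :
    tensorLeft n (h + k) ψ = tensorLeft n h ψ + tensorLeft n k ψ :=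
  (congrArg UniformSpace.Completion.coe' (TensorProduct.add_tmul h k ψ)).trans
    (UniformSpace.Completion.coe_add _ _)

theorem tensorLeft_smul (n : ℕ) (c : ℂ) (h : H) (ψ : HTensor H n) :
    tensorLeft n (c • h) ψ = c • tensorLeft n h ψ :=
  (congrArg UniformSpace.Completion.coe' (TensorProduct.smul_tmul' c h ψ).symm).trans
    (UniformSpace.Completion.coe_smul _ _)

theorem inner_purePow (k l : H) (n : ℕ) : ⟪purePow k n, purePow l n⟫_ℂ = ⟪k, l⟫_ℂ ^ n := by
  induction n with
  | zero =>
    change ⟪(1 : ℂ), (1 : ℂ)⟫_ℂ = _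
    simp
  | succ n ih =>
    rw [pow_succ', ← ih]
    exact inner_tensorLeft n k l _ _

/-- The pure power `k ⊗ ⋯ ⊗ k` as an `n`-particle vector. -/
def symPow (k : H) (n : ℕ) : NParticle H n :=
  (⟨purePow k n, Submodule.le_topologicalClosure _ (Submodule.subset_span ⟨k, rfl⟩)⟩ :
    symTensor H n)

theorem inner_symPow (k l : H) (n : ℕ) : ⟪symPow k n, symPow l n⟫_ℂ = ⟪k, l⟫_ℂ ^ n :=
  inner_purePow k l n

theorem proj_purePow (k : H) (n : ℕ) : NParticle.proj H n (purePow k n) = symPow k n :=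
  (symTensor H n).orthogonalProjectionOnto_mem_subspace_eq_self (symPow k n : symTensor H n)

theorem inner_proj_left (n : ℕ) (ψ : HTensor H n) (φ : NParticle H n) :
    ⟪NParticle.proj H n ψ, φ⟫_ℂ = ⟪ψ, NParticle.incl H n φ⟫_ℂ :=
  Submodule.inner_orthogonalProjectionOnto_eq_of_mem_right (K := symTensor H n) φ ψ

theorem norm_incl (n : ℕ) (φ : NParticle H n) : ‖NParticle.incl H n φ‖ = ‖φ‖ := rfl

theorem norm_proj_le (n : ℕ) (ψ : HTensor H n) : ‖NParticle.proj H n ψ‖ ≤ ‖ψ‖ :=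
  (symTensor H n).norm_orthogonalProjectionOnto_apply_le ψ

/-- The pure powers span a dense subspace by the definition of `symTensor`. Hence identities of
vectors and bounded operators can be tested on them, and sums over permutations never appear. -/
theorem eq_zero_of_inner_symPow (n : ℕ) (φ : NParticle H n)
    (h : ∀ k : H, ⟪symPow k n, φ⟫_ℂ = 0) : φ = 0 := by
  have h1 : symTensor H n ≤ (ℂ ∙ (NParticle.incl H n φ))ᗮ := by
    refine Submodule.topologicalClosure_minimal _ (Submodule.span_le.2 ?_)
      (Submodule.isClosed_orthogonal _)
    rintro _ ⟨k, rfl⟩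
    exact Submodule.mem_orthogonal_singleton_iff_inner_left.2 (h k)
  have h2 : NParticle.incl H n φ ∈ symTensor H n := (φ : symTensor H n).2
  have h3 := Submodule.mem_orthogonal_singleton_iff_inner_left.1 (h1 h2)
  have h4 : ‖NParticle.incl H n φ‖ = 0 := norm_eq_zero.2 (inner_self_eq_zero.1 h3)
  rw [norm_incl] at h4
  exact norm_eq_zero.1 h4

theorem ext_inner_symPow (n : ℕ) {φ χ : NParticle H n}
    (h : ∀ k : H, ⟪symPow k n, φ⟫_ℂ = ⟪symPow k n, χ⟫_ℂ) : φ = χ :=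
  sub_eq_zero.1 (eq_zero_of_inner_symPow n _ fun k => by rw [inner_sub_right, h, sub_self])

/-- Bounded operators on the `n`-particle space are determined by the pure powers. -/
theorem ext_symPow {F : Type*} [NormedAddCommGroup F] [InnerProductSpace ℂ F] [CompleteSpace F]
    {n : ℕ} {S T : NParticle H n →L[ℂ] F} (h : ∀ k : H, S (symPow k n) = T (symPow k n)) :
    S = T := by
  have h1 : ContinuousLinearMap.adjoint S = ContinuousLinearMap.adjoint T := by
    ext1 φ
    refine ext_inner_symPow n fun k => ?_
    rw [ContinuousLinearMap.adjoint_inner_right, ContinuousLinearMap.adjoint_inner_right, h]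
  exact (ContinuousLinearMap.adjoint).injective h1

theorem creationStep_apply (n : ℕ) (h : H) (φ : NParticle H n) :
    creationStep n h φ = ((Real.sqrt (n + 1) : ℝ) : ℂ) •
      NParticle.proj H (n + 1) (tensorLeft n h (NParticle.incl H n φ)) := rfl

theorem norm_creationStep_apply_le (n : ℕ) (h : H) (φ : NParticle H n) :
    ‖creationStep n h φ‖ ≤ Real.sqrt (n + 1) * ‖h‖ * ‖φ‖ := by
  rw [creationStep_apply, norm_smul, norm_real, Real.norm_of_nonneg (Real.sqrt_nonneg _), mul_assoc]
  gcongr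
  refine (norm_proj_le _ _).trans ?_
  rw [norm_tensorLeft, norm_incl]

theorem norm_adjoint_creationStep_apply_le (n : ℕ) (h : H) (φ : NParticle H (n + 1)) :
    ‖ContinuousLinearMap.adjoint (creationStep n h) φ‖ ≤ Real.sqrt (n + 1) * ‖h‖ * ‖φ‖ := by
  refine ((ContinuousLinearMap.adjoint (creationStep n h)).le_opNorm φ).trans ?_
  rw [LinearIsometryEquiv.norm_map]
  gcongr
  exact ContinuousLinearMap.opNorm_le_bound _ (by positivity) (norm_creationStep_apply_le n h)

theorem creationStep_smul (n : ℕ) (c : ℂ) (h : H) :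
    creationStep n (c • h) = c • creationStep n h := by
  ext1 φ
  simp only [creationStep_apply, tensorLeft_smul, map_smul, smul_apply, smul_comm c]

theorem inner_symPow_creationStep (n : ℕ) (h l : H) (φ : NParticle H n) :
    ⟪symPow l (n + 1), creationStep n h φ⟫_ℂ =
      ((Real.sqrt (n + 1) : ℝ) : ℂ) * (⟪l, h⟫_ℂ * ⟪symPow l n, φ⟫_ℂ) := by
  rw [creationStep_apply, inner_smul_right, ← inner_conj_symm, inner_proj_left, inner_conj_symm]
  congr 1
  exact inner_tensorLeft n l h (purePow l n) (NParticle.incl H n φ)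

/-- Annihilation keeps pure powers pure up to a scalar, so products of annihilators are computed
there directly. Creation does not, and is treated through adjoints or through `hasDerivAt_symPow`.
-/
theorem adjoint_creationStep_symPow (n : ℕ) (h k : H) :
    ContinuousLinearMap.adjoint (creationStep n h) (symPow k (n + 1)) =
      (((Real.sqrt (n + 1) : ℝ) : ℂ) * ⟪h, k⟫_ℂ) • symPow k n := by
  refine ext_inner_left ℂ fun φ => ?_
  rw [ContinuousLinearMap.adjoint_inner_right, ← inner_conj_symm, inner_symPow_creationStep,
    inner_smul_right, map_mul, map_mul, inner_conj_symm, inner_conj_symm, conj_ofReal]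
  ring

/-- Two annihilation operators commute. -/
theorem adjoint_creationStep_comm (n : ℕ) (h k : H) (φ : NParticle H (n + 2)) :
    ContinuousLinearMap.adjoint (creationStep n h)
        (ContinuousLinearMap.adjoint (creationStep (n + 1) k) φ) =
      ContinuousLinearMap.adjoint (creationStep n k)
        (ContinuousLinearMap.adjoint (creationStep (n + 1) h) φ) := by
  have : (ContinuousLinearMap.adjoint (creationStep n h)).comp
        (ContinuousLinearMap.adjoint (creationStep (n + 1) k)) =
      (ContinuousLinearMap.adjoint (creationStep n k)).comp
        (ContinuousLinearMap.adjoint (creationStep (n + 1) h)) := by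
    refine ext_symPow fun l => ?_
    simp only [ContinuousLinearMap.comp_apply, adjoint_creationStep_symPow, map_smul, smul_smul]
    congr 1
    ring
  exact DFunLike.congr_fun this φ

/-- Two creation operators commute. -/
theorem creationStep_comm (n : ℕ) (h k : H) (φ : NParticle H n) :
    creationStep (n + 1) h (creationStep n k φ) = creationStep (n + 1) k (creationStep n h φ) := by
  refine ext_inner_left ℂ fun χ => ?_
  rw [← ContinuousLinearMap.adjoint_inner_left, ← ContinuousLinearMap.adjoint_inner_left,
    adjoint_creationStep_comm, ContinuousLinearMap.adjoint_inner_left,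
    ContinuousLinearMap.adjoint_inner_left]

/-- The derivative at `s = 0` of the pure power of `k + s h`. -/
def purePowDeriv (k h : H) : (n : ℕ) → HTensor H n
  | 0 => (0 : ℂ)
  | n + 1 => tensorLeft n k (purePowDeriv k h n) + tensorLeft n h (purePow k n)

theorem hasDerivAt_purePow (k h : H) (n : ℕ) :
    HasDerivAt (fun s : ℂ => purePow (k + s • h) n) (purePowDeriv k h n) 0 := by
  induction n with
  | zero => exact hasDerivAt_const (0 : ℂ) (1 : ℂ)
  | succ n ih =>
    have h1 : HasDerivAt (fun s : ℂ => tensorLeft n k (purePow (k + s • h) n))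
        (tensorLeft n k (purePowDeriv k h n)) 0 :=
      (tensorLeft n k).hasFDerivAt.comp_hasDerivAt (0 : ℂ) ih
    have h2 : HasDerivAt (fun s : ℂ => s • tensorLeft n h (purePow (k + s • h) n))
        ((0 : ℂ) • tensorLeft n h (purePowDeriv k h n) +
          (1 : ℂ) • tensorLeft n h (purePow (k + (0 : ℂ) • h) n)) 0 :=
      (hasDerivAt_id (0 : ℂ)).fun_smul ((tensorLeft n h).hasFDerivAt.comp_hasDerivAt (0 : ℂ) ih)
    have h3 := h1.fun_add h2
    rw [zero_smul, zero_smul, zero_add, one_smul, add_zero] at h3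
    refine h3.congr_of_eventuallyEq (Eventually.of_forall fun s => ?_)
    change tensorLeft n (k + s • h) (purePow (k + s • h) n) = _
    rw [tensorLeft_add, tensorLeft_smul]

/-- Creation leaves the pure powers but is a directional derivative of them. Differentiability comes
from `purePowDeriv`; the value of the derivative is then read off from inner products with pure
powers, which are polynomials in s. -/
theorem hasDerivAt_symPow (k h : H) (n : ℕ) :
    HasDerivAt (fun s : ℂ => symPow (k + s • h) (n + 1))
      (((Real.sqrt (n + 1) : ℝ) : ℂ) • creationStep n h (symPow k n)) 0 := by
  have h1 : HasDerivAt (fun s : ℂ => symPow (k + s • h) (n + 1))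
      (NParticle.proj H (n + 1) (purePowDeriv k h (n + 1))) 0 := by
    refine ((NParticle.proj H (n + 1)).hasFDerivAt.comp_hasDerivAt (0 : ℂ)
      (hasDerivAt_purePow k h (n + 1))).congr_of_eventuallyEq (Eventually.of_forall fun s => ?_)
    exact (proj_purePow _ _).symm
  refine h1.congr_deriv (ext_inner_symPow _ fun l => ?_)
  have h2 : HasDerivAt (fun s : ℂ => ⟪symPow l (n + 1), symPow (k + s • h) (n + 1)⟫_ℂ)
      ⟪symPow l (n + 1), NParticle.proj H (n + 1) (purePowDeriv k h (n + 1))⟫_ℂ 0 :=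
    (innerSL ℂ (symPow l (n + 1))).hasFDerivAt.comp_hasDerivAt (0 : ℂ) h1
  have h3 : HasDerivAt (fun s : ℂ => ⟪symPow l (n + 1), symPow (k + s • h) (n + 1)⟫_ℂ)
      (((n + 1 : ℕ) : ℂ) * ⟪l, k⟫_ℂ ^ n * ⟪l, h⟫_ℂ) 0 := by
    simp only [inner_symPow, inner_add_right, inner_smul_right]
    have := (((hasDerivAt_id (0 : ℂ)).mul_const ⟪l, h⟫_ℂ).const_add ⟪l, k⟫_ℂ).fun_pow (n + 1)
    simpa using this
  rw [h2.unique h3, inner_smul_right, inner_symPow_creationStep, inner_symPow, ← mul_assoc,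
    ← ofReal_mul, Real.mul_self_sqrt (by positivity)]
  push_cast
  ring

/-- The canonical commutation relation. -/
theorem adjoint_creationStep_creationStep (n : ℕ) (f h : H) (φ : NParticle H (n + 1)) :
    ContinuousLinearMap.adjoint (creationStep (n + 1) f) (creationStep (n + 1) h φ) =
      creationStep n h (ContinuousLinearMap.adjoint (creationStep n f) φ) + ⟪f, h⟫_ℂ • φ := by
  have : (ContinuousLinearMap.adjoint (creationStep (n + 1) f)).comp (creationStep (n + 1) h) =
      (creationStep n h).comp (ContinuousLinearMap.adjoint (creationStep n f)) +
        ⟪f, h⟫_ℂ • ContinuousLinearMap.id ℂ _ := by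
    refine ext_symPow fun k => ?_
    -- Apply a(f) to the curve of pure powers of k + sh. Its value is √(n+2) (f, k + sh) times a
    -- lower pure power, and the product rule at s = 0 gives the two terms of the relation.
    have h1 := ((ContinuousLinearMap.adjoint (creationStep (n + 1) f)).hasFDerivAt).comp_hasDerivAt
      (0 : ℂ) (hasDerivAt_symPow k h (n + 1))
    have h2 : HasDerivAt (fun s : ℂ => (((Real.sqrt ((n + 1 : ℕ) + 1) : ℝ) : ℂ) *
        (⟪f, k⟫_ℂ + s * ⟪f, h⟫_ℂ)) • symPow (k + s • h) (n + 1)) _ 0 :=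
      HasDerivAt.fun_smul ((((hasDerivAt_id (0 : ℂ)).mul_const ⟪f, h⟫_ℂ).const_add
        ⟪f, k⟫_ℂ).const_mul _) (hasDerivAt_symPow k h n)
    have h3 := h1.unique (h2.congr_of_eventuallyEq (Eventually.of_forall fun s => by
      simp only [Function.comp_apply, adjoint_creationStep_symPow, inner_add_right,
        inner_smul_right]))
    have hne : ((Real.sqrt ((n + 1 : ℕ) + 1) : ℝ) : ℂ) ≠ 0 :=
      ofReal_ne_zero.2 (Real.sqrt_ne_zero'.2 (by positivity))
    simp only [zero_mul, add_zero, zero_smul, one_mul, map_smul, mul_smul, ← smul_add] at h3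
    have h4 := smul_right_injective _ hne h3
    simp only [add_apply, smul_apply, ContinuousLinearMap.comp_apply, ContinuousLinearMap.id_apply,
      adjoint_creationStep_symPow, map_smul]
    rw [h4, mul_smul, smul_comm ⟪f, k⟫_ℂ]
  exact DFunLike.congr_fun this φ

theorem creationStep_symPow_zero (h k : H) : creationStep 0 h (symPow k 0) = symPow h 1 := by
  rw [creationStep_apply, ← proj_purePow h 1]
  simp only [Nat.cast_zero, zero_add, Real.sqrt_one, ofReal_one, one_smul]
  rfl

/-- The canonical commutation relation on the vacuum sector. -/
theorem adjoint_creationStep_creationStep_zero (f h : H) (φ : NParticle H 0) :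
    ContinuousLinearMap.adjoint (creationStep 0 f) (creationStep 0 h φ) = ⟪f, h⟫_ℂ • φ := by
  have : (ContinuousLinearMap.adjoint (creationStep 0 f)).comp (creationStep 0 h) =
      ⟪f, h⟫_ℂ • ContinuousLinearMap.id ℂ _ := by
    refine ext_symPow fun k => ?_
    rw [ContinuousLinearMap.comp_apply, creationStep_symPow_zero, adjoint_creationStep_symPow]
    simp only [Nat.cast_zero, zero_add, Real.sqrt_one, ofReal_one, one_mul, smul_apply,
      ContinuousLinearMap.id_apply]
    rfl
  exact DFunLike.congr_fun this φ

end FockSpace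

/-! ### Field operators on finite-particle vectors -/

section FieldOperators

open Filter Topology

variable {H : Type} [NormedAddCommGroup H] [InnerProductSpace ℂ H]

theorem finiteParticle_ext {ψ φ : finiteParticle H} (h : ∀ n, (ψ : Fock H) n = (φ : Fock H) n) :
    ψ = φ :=
  Subtype.ext (lp.ext (funext h))

theorem creation_apply_zero (h : H) (ψ : finiteParticle H) :
    (creation h ψ : Fock H) 0 = 0 := rfl

theorem creation_apply_succ (h : H) (ψ : finiteParticle H) (n : ℕ) :
    (creation h ψ : Fock H) (n + 1) = creationStep n h ((ψ : Fock H) n) := rfl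

theorem annihilation_apply (h : H) (ψ : finiteParticle H) (n : ℕ) :
    (annihilation h ψ : Fock H) n =
      ContinuousLinearMap.adjoint (creationStep n h) ((ψ : Fock H) (n + 1)) := rfl

theorem finiteParticle_add_apply (ψ φ : finiteParticle H) (n : ℕ) :
    ((ψ + φ : finiteParticle H) : Fock H) n = (ψ : Fock H) n + (φ : Fock H) n := rfl

theorem finiteParticle_smul_apply (c : ℂ) (ψ : finiteParticle H) (n : ℕ) :
    ((c • ψ : finiteParticle H) : Fock H) n = c • (ψ : Fock H) n := rfl

theorem creation_comm (h k : H) (ψ : finiteParticle H) :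
    creation h (creation k ψ) = creation k (creation h ψ) := by
  refine finiteParticle_ext fun n => ?_
  rcases n with _ | _ | n
  · rfl
  · simp only [creation_apply_succ, creation_apply_zero, map_zero]
  · exact creationStep_comm n h k _

theorem annihilation_comm (h k : H) (ψ : finiteParticle H) :
    annihilation h (annihilation k ψ) = annihilation k (annihilation h ψ) :=
  finiteParticle_ext fun n => adjoint_creationStep_comm n h k _

theorem annihilation_creation (f h : H) (ψ : finiteParticle H) :
    annihilation f (creation h ψ) = creation h (annihilation f ψ) + ⟪f, h⟫_ℂ • ψ := by
  refine finiteParticle_ext fun n => ?_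
  rw [finiteParticle_add_apply, finiteParticle_smul_apply, annihilation_apply, creation_apply_succ]
  rcases n with _ | n
  · exact (adjoint_creationStep_creationStep_zero f h _).trans (zero_add _).symm
  · rw [creation_apply_succ, annihilation_apply, adjoint_creationStep_creationStep]

theorem hasSum_inner_fock (ψ φ : Fock H) : HasSum (fun n => ⟪ψ n, φ n⟫_ℂ) ⟪ψ, φ⟫_ℂ :=
  lp.hasSum_inner ψ φ

theorem inner_creation_left (h : H) (ψ φ : finiteParticle H) :
    ⟪(creation h ψ : Fock H), (φ : Fock H)⟫_ℂ = ⟪(ψ : Fock H), (annihilation h φ : Fock H)⟫_ℂ := by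
  have h1 := (hasSum_nat_add_iff' 1).2 (hasSum_inner_fock (creation h ψ : Fock H) (φ : Fock H))
  rw [Finset.sum_range_one, creation_apply_zero, inner_zero_left, sub_zero] at h1
  refine h1.unique ((hasSum_inner_fock (ψ : Fock H) (annihilation h φ : Fock H)).congr_fun
    fun n => ?_)
  rw [creation_apply_succ, annihilation_apply, ContinuousLinearMap.adjoint_inner_right]

theorem inner_annihilation_left (h : H) (ψ φ : finiteParticle H) :
    ⟪(annihilation h ψ : Fock H), (φ : Fock H)⟫_ℂ = ⟪(ψ : Fock H), (creation h φ : Fock H)⟫_ℂ := by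
  rw [← inner_conj_symm, ← inner_creation_left, inner_conj_symm]

theorem hasSum_norm_sq (ψ : Fock H) : HasSum (fun n => ‖ψ n‖ ^ 2) (‖ψ‖ ^ 2) := by
  have := lp.hasSum_norm (p := 2) (by simp) ψ
  simpa using this

/-- The finite-particle vector `ψ` has at most `M` particles. -/
def AtMost (M : ℕ) (ψ : finiteParticle H) : Prop := ∀ n, M < n → (ψ : Fock H) n = 0

theorem exists_atMost (ψ : finiteParticle H) : ∃ M, AtMost M ψ := by
  obtain ⟨M, hM⟩ := ψ.2.bddAbove
  refine ⟨M, fun n hn => ?_⟩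
  by_contra hc
  exact absurd (hM hc) (not_le.2 hn)

theorem AtMost.creation {M : ℕ} {ψ : finiteParticle H} (hψ : AtMost M ψ) (h : H) :
    AtMost (M + 1) (creation h ψ) := by
  rintro (_ | n) hn
  · rfl
  · rw [creation_apply_succ, hψ n (by omega), map_zero]

theorem AtMost.annihilation {M : ℕ} {ψ : finiteParticle H} (hψ : AtMost M ψ) (h : H) :
    AtMost (M + 1) (annihilation h ψ) := by
  intro n hn
  rw [annihilation_apply, hψ (n + 1) (by omega), map_zero]

theorem AtMost.norm_creation_le {M : ℕ} {ψ : finiteParticle H} (hψ : AtMost M ψ) (h : H) :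
    ‖PointSource.creation h ψ‖ ≤ Real.sqrt (M + 1) * ‖h‖ * ‖ψ‖ := by
  refine le_of_sq_le_sq (a := ‖((PointSource.creation h ψ : finiteParticle H) : Fock H)‖)
    (b := Real.sqrt (M + 1) * ‖h‖ * ‖(ψ : Fock H)‖) ?_ (by positivity)
  have h1 := (hasSum_nat_add_iff' 1).2
    (hasSum_norm_sq ((PointSource.creation h ψ : finiteParticle H) : Fock H))
  rw [Finset.sum_range_one, creation_apply_zero, norm_zero, zero_pow two_ne_zero, sub_zero] at h1
  rw [mul_pow _ ‖(ψ : Fock H)‖]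
  refine hasSum_le (fun n => ?_) h1 ((hasSum_norm_sq (ψ : Fock H)).mul_left _)
  rw [creation_apply_succ, ← mul_pow]
  rcases lt_or_ge M n with hn | hn
  · rw [hψ n hn, map_zero, norm_zero, norm_zero, mul_zero]
  · gcongr
    refine (norm_creationStep_apply_le n h _).trans ?_
    gcongr

theorem AtMost.norm_annihilation_le {M : ℕ} {ψ : finiteParticle H} (hψ : AtMost M ψ) (h : H) :
    ‖PointSource.annihilation h ψ‖ ≤ Real.sqrt (M + 1) * ‖h‖ * ‖ψ‖ := by
  refine le_of_sq_le_sq (a := ‖((PointSource.annihilation h ψ : finiteParticle H) : Fock H)‖)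
    (b := Real.sqrt (M + 1) * ‖h‖ * ‖(ψ : Fock H)‖) ?_ (by positivity)
  have h1 := (hasSum_nat_add_iff' 1).2 (hasSum_norm_sq (ψ : Fock H))
  rw [Finset.sum_range_one] at h1
  have h2 := hasSum_le (fun n => ?_)
    (hasSum_norm_sq ((PointSource.annihilation h ψ : finiteParticle H) : Fock H))
    (h1.mul_left ((Real.sqrt (M + 1) * ‖h‖) ^ 2))
  · rw [mul_pow _ ‖(ψ : Fock H)‖]
    refine h2.trans ?_
    gcongr
    linarith [sq_nonneg ‖(ψ : Fock H) 0‖]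
  · rw [annihilation_apply, ← mul_pow]
    rcases lt_or_ge M n with hn | hn
    · rw [hψ (n + 1) (by omega), map_zero, norm_zero, norm_zero, mul_zero]
    · gcongr
      refine (norm_adjoint_creationStep_apply_le n h _).trans ?_
      gcongr

/-- The field operator `2^{-1/2} (a*(h) + a(h))`. -/
abbrev field (h : H) : finiteParticle H →ₗ[ℂ] finiteParticle H :=
  fieldOf (creation h) (annihilation h)

theorem field_apply (h : H) (ψ : finiteParticle H) :
    field h ψ = (((Real.sqrt 2)⁻¹ : ℝ) : ℂ) • (creation h ψ + annihilation h ψ) := rfl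

theorem inner_field_left (h : H) (ψ φ : finiteParticle H) :
    ⟪(field h ψ : Fock H), (φ : Fock H)⟫_ℂ = ⟪(ψ : Fock H), (field h φ : Fock H)⟫_ℂ := by
  simp only [field_apply, Submodule.coe_smul, Submodule.coe_add, inner_smul_left, inner_smul_right,
    inner_add_left, inner_add_right, inner_creation_left, inner_annihilation_left, conj_ofReal,
    add_comm]

theorem inv_sqrt_two_mul_self :
    (((Real.sqrt 2)⁻¹ : ℝ) : ℂ) * (((Real.sqrt 2)⁻¹ : ℝ) : ℂ) = 1 / 2 := by
  rw [← ofReal_mul, ← mul_inv, Real.mul_self_sqrt (by norm_num)]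
  norm_num

/-- Only the mixed terms contribute to the commutator, which is the number i Im (h, f). -/
theorem field_comm (h f : H) (ψ : finiteParticle H) :
    field h (field f ψ) = field f (field h ψ) + ((⟪h, f⟫_ℂ - ⟪f, h⟫_ℂ) / 2) • ψ := by
  simp only [field_apply, map_smul, map_add, annihilation_creation, creation_comm h f,
    annihilation_comm h f]
  have hs := inv_sqrt_two_mul_self
  rw [ofReal_inv] at hs
  match_scalars <;> try ring1
  linear_combination (⟪h, f⟫_ℂ - ⟪f, h⟫_ℂ) * hs

theorem AtMost.field {M : ℕ} {ψ : finiteParticle H} (hψ : AtMost M ψ) (h : H) :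
    AtMost (M + 1) (field h ψ) := by
  intro n hn
  rw [field_apply, finiteParticle_smul_apply, finiteParticle_add_apply, hψ.creation h n hn,
    hψ.annihilation h n hn, add_zero, smul_zero]

theorem AtMost.norm_field_le {M : ℕ} {ψ : finiteParticle H} (hψ : AtMost M ψ) (h : H) :
    ‖PointSource.field h ψ‖ ≤ 2 * ‖h‖ * Real.sqrt (M + 1) * ‖ψ‖ := by
  rw [field_apply, norm_smul, norm_real, Real.norm_of_nonneg (by positivity)]
  have h1 : (Real.sqrt 2)⁻¹ ≤ 1 := inv_le_one_of_one_le₀ (Real.one_le_sqrt.2 (by norm_num))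
  calc (Real.sqrt 2)⁻¹ * ‖PointSource.creation h ψ + PointSource.annihilation h ψ‖
      ≤ 1 * (Real.sqrt (M + 1) * ‖h‖ * ‖ψ‖ + Real.sqrt (M + 1) * ‖h‖ * ‖ψ‖) := by
        gcongr
        exact (norm_add_le _ _).trans
          (add_le_add (hψ.norm_creation_le h) (hψ.norm_annihilation_le h))
    _ = 2 * ‖h‖ * Real.sqrt (M + 1) * ‖ψ‖ := by ring

theorem AtMost.field_pow {M : ℕ} {ψ : finiteParticle H} (hψ : AtMost M ψ) (h : H) (k : ℕ) :
    AtMost (M + k) ((PointSource.field h ^ k) ψ) ∧ ‖(PointSource.field h ^ k) ψ‖ ≤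
      (∏ j ∈ Finset.range k, (2 * ‖h‖ * Real.sqrt ((M + j : ℕ) + 1))) * ‖ψ‖ := by
  induction k with
  | zero => exact ⟨hψ, by simp⟩
  | succ k ih =>
    rw [pow_succ', Module.End.mul_apply]
    refine ⟨ih.1.field h, (ih.1.norm_field_le h).trans ?_⟩
    rw [Finset.prod_range_succ, mul_comm (∏ j ∈ _, _), mul_assoc (2 * ‖h‖ * _)]
    exact mul_le_mul_of_nonneg_left ih.2 (by positivity)

/-- The product is Cᵏ √((M+k)!/M!), so the ratio of consecutive terms decays like k to the power
-1/2. -/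
theorem summable_pow_div_factorial_mul_prod_sqrt (r C : ℝ) (hC : 0 ≤ C) (M : ℕ) :
    Summable fun k : ℕ => r ^ k / (k.factorial : ℝ) *
      ∏ j ∈ Finset.range k, (C * Real.sqrt ((M + j : ℕ) + 1)) := by
  have hlim : Tendsto (fun k : ℕ => Real.sqrt ((k : ℝ) + 1)) atTop atTop :=
    Real.tendsto_sqrt_atTop.comp (tendsto_atTop_add_const_right _ _ tendsto_natCast_atTop_atTop)
  refine summable_of_ratio_norm_eventually_le (r := 1 / 2) (by norm_num) ?_
  -- With √(M+k+1) ≤ √(M+1) √(k+1), this threshold makes the ratio at most 1/2.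
  filter_upwards [hlim.eventually_ge_atTop (2 * (|r| * (C * Real.sqrt (M + 1))))] with k hk
  have hs : 0 < Real.sqrt ((k : ℝ) + 1) := Real.sqrt_pos.2 (by positivity)
  have h1 : Real.sqrt ((M + k : ℕ) + 1) ≤ Real.sqrt (M + 1) * Real.sqrt (k + 1) := by
    rw [← Real.sqrt_mul (by positivity)]
    refine Real.sqrt_le_sqrt ?_
    push_cast
    nlinarith [mul_nonneg (Nat.cast_nonneg (α := ℝ) M) (Nat.cast_nonneg (α := ℝ) k)]
  have h2 : |r| * (C * Real.sqrt ((M + k : ℕ) + 1)) / (k + 1) ≤ 1 / 2 := by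
    rw [div_le_iff₀ (by positivity)]
    calc |r| * (C * Real.sqrt ((M + k : ℕ) + 1))
        ≤ |r| * (C * (Real.sqrt (M + 1) * Real.sqrt (k + 1))) := by gcongr
      _ = |r| * (C * Real.sqrt (M + 1)) * Real.sqrt (k + 1) := by ring
      _ ≤ (1 / 2 * Real.sqrt (k + 1)) * Real.sqrt (k + 1) :=
        mul_le_mul_of_nonneg_right (by linarith) hs.le
      _ = 1 / 2 * (k + 1) := by rw [mul_assoc, Real.mul_self_sqrt (by positivity)]
  have h3 : r ^ (k + 1) / ((k + 1).factorial : ℝ) *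
      ∏ j ∈ Finset.range (k + 1), (C * Real.sqrt ((M + j : ℕ) + 1)) =
      (r * (C * Real.sqrt ((M + k : ℕ) + 1)) / (k + 1)) * (r ^ k / (k.factorial : ℝ) *
      ∏ j ∈ Finset.range k, (C * Real.sqrt ((M + j : ℕ) + 1))) := by
    rw [Finset.prod_range_succ, Nat.factorial_succ, Nat.cast_mul, Nat.cast_succ, pow_succ]
    have : (k.factorial : ℝ) ≠ 0 := by exact_mod_cast k.factorial_ne_zero
    field_simp
  rw [h3, norm_mul]
  gcongr
  refine le_of_eq_of_le ?_ h2
  rw [Real.norm_eq_abs, abs_div, abs_mul, abs_of_nonneg (a := C * _) (by positivity),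
    abs_of_nonneg (a := (k : ℝ) + 1) (by positivity)]

theorem isEntire_field (h : H) : IsEntire (field h) := by
  intro ψ r
  obtain ⟨M, hM⟩ := exists_atMost ψ
  refine Summable.of_norm_bounded
    ((summable_pow_div_factorial_mul_prod_sqrt |r| (2 * ‖h‖) (by positivity) M).mul_right ‖ψ‖)
    fun k => ?_
  rw [norm_mul, norm_div, norm_pow, norm_norm, Real.norm_eq_abs, RCLike.norm_natCast, mul_assoc]
  gcongr
  exact (hM.field_pow h k).2

theorem dense_finiteParticle : Dense (finiteParticle H : Set (Fock H)) := by
  classical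
  intro ψ
  have h1 := lp.hasSum_single (p := 2) (by simp) ψ
  refine mem_closure_of_tendsto h1 (Eventually.of_forall fun s => ?_)
  refine Submodule.sum_mem _ fun n _ => ?_
  refine (Set.finite_singleton n).subset fun m hm => ?_
  by_contra hc
  exact hm (lp.single_apply_ne 2 n _ hc)

end FieldOperators

/-! ### Weyl operators and their commutation relation -/

section WeylOperators

open Filter Topology

variable {H : Type} [NormedAddCommGroup H] [InnerProductSpace ℂ H]
  {A : finiteParticle H →ₗ[ℂ] finiteParticle H} {U V : ℝ → (Fock H →L[ℂ] Fock H)}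

theorem norm_apply_of_mem_unitary {W : Fock H →L[ℂ] Fock H}
    (hW : W ∈ unitary (Fock H →L[ℂ] Fock H)) (ψ : Fock H) : ‖W ψ‖ = ‖ψ‖ :=
  (ContinuousLinearMap.norm_map_iff_adjoint_comp_self W).2 (Unitary.mem_iff.1 hW).1 ψ

theorem IsUnitaryGroup.norm_apply (hU : IsUnitaryGroup A U) (t : ℝ) (ψ : Fock H) :
    ‖U t ψ‖ = ‖ψ‖ :=
  norm_apply_of_mem_unitary (hU.unitary_mem t) ψ

theorem IsEntire.isUnitaryGroup_expCLM (hA : IsEntire A)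
    (hsym : ∀ ψ φ : finiteParticle H,
      ⟪(A ψ : Fock H), (φ : Fock H)⟫_ℂ = ⟪(ψ : Fock H), (A φ : Fock H)⟫_ℂ) :
    IsUnitaryGroup A (expCLM A hA) where
  unitary_mem := expCLM_mem_unitary dense_finiteParticle hA hsym
  map_zero := expCLM_zero dense_finiteParticle hA hsym
  map_add := expCLM_add dense_finiteParticle hA hsym
  continuous := continuous_apply_of_dense dense_finiteParticle
    (norm_expCLM dense_finiteParticle hA hsym) (expCLM_add dense_finiteParticle hA hsym)
    fun φ => (hasDerivAt_expCLM dense_finiteParticle hA hsym φ).continuousAt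
  hasDerivAt := hasDerivAt_expCLM dense_finiteParticle hA hsym

theorem IsUnitaryGroup.one_apply (hU : IsUnitaryGroup A U) (hA : IsEntire A)
    (ψ : finiteParticle H) : U 1 (ψ : Fock H) = expVec A I ψ :=
  hA.group_one_apply hU.norm_apply hU.map_zero hU.map_add hU.hasDerivAt ψ

/-- Both sides are given by the same series on a dense set. This makes the arbitrary choice in
`expI` harmless. -/
theorem IsUnitaryGroup.one_unique (hU : IsUnitaryGroup A U) (hV : IsUnitaryGroup A V)
    (hA : IsEntire A) : U 1 = V 1 := by
  refine ContinuousLinearMap.coeFn_injective (Continuous.ext_on dense_finiteParticle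
    (U 1).continuous (V 1).continuous fun ψ hψ => ?_)
  exact (hU.one_apply hA ⟨ψ, hψ⟩).trans (hV.one_apply hA ⟨ψ, hψ⟩).symm

/-- Adding a real constant to the generator multiplies the group by a phase. -/
theorem IsUnitaryGroup.add_const (hU : IsUnitaryGroup A U) (c : ℝ) :
    IsUnitaryGroup (A + (c : ℂ) • LinearMap.id) fun t => exp (I * (c * t : ℝ)) • U t where
  unitary_mem t := by
    obtain ⟨h1, h2⟩ := Unitary.mem_iff.1 (hU.unitary_mem t)
    have h3 : star (exp (I * (c * t : ℝ))) * exp (I * (c * t : ℝ)) = 1 := by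
      rw [RCLike.star_def, ← exp_conj, ← exp_add, map_mul, conj_I, conj_ofReal, neg_mul,
        neg_add_cancel, exp_zero]
    refine Unitary.mem_iff.2 ⟨?_, ?_⟩
    · rw [star_smul, smul_mul_smul_comm, h1, h3, one_smul]
    · rw [star_smul, smul_mul_smul_comm, h2, mul_comm, h3, one_smul]
  map_zero := by simp [hU.map_zero]
  map_add s t := by
    rw [smul_mul_smul_comm, ← exp_add, hU.map_add]
    congr 2
    push_cast
    ring
  continuous ψ := by
    have := hU.continuous ψ
    simp only [smul_apply]
    fun_prop
  hasDerivAt ψ := by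
    have h1 : HasDerivAt (fun t : ℝ => exp (I * (c * t : ℝ))) (I * c) 0 := by
      have := ((((hasDerivAt_id (0 : ℝ)).const_mul c).ofReal_comp).const_mul I).cexp
      simpa using this
    refine (h1.fun_smul (hU.hasDerivAt ψ)).congr_deriv ?_
    rw [hU.map_zero]
    simp only [mul_zero, ofReal_zero, exp_zero, one_mul, one_apply_eq_self, LinearMap.add_apply,
      LinearMap.smul_apply, LinearMap.id_apply, Submodule.coe_add, Submodule.coe_smul, smul_add,
      smul_smul]

theorem IsUnitaryGroup.expI_eq (hU : IsUnitaryGroup A U) (hA : IsEntire A) : expI A = U 1 := by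
  have hex : ∃ U : ℝ → (Fock H →L[ℂ] Fock H), IsUnitaryGroup A U := ⟨U, hU⟩
  rw [expI, dif_pos hex]
  exact hex.choose_spec.one_unique hU hA

/-- Removing the constant turns V into a group for A, so uniqueness for A suffices and A + c need
not be shown to be entire. -/
theorem IsUnitaryGroup.one_eq_smul (hU : IsUnitaryGroup A U) (hA : IsEntire A) {c : ℝ}
    (hV : IsUnitaryGroup (A + (c : ℂ) • LinearMap.id) V) : V 1 = exp (I * c) • U 1 := by
  have h1 := hV.add_const (-c)
  have h2 : A + (c : ℂ) • LinearMap.id + ((-c : ℝ) : ℂ) • LinearMap.id = A := by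
    refine LinearMap.ext fun ψ => ?_
    simp only [LinearMap.add_apply, LinearMap.smul_apply, LinearMap.id_apply, ofReal_neg, neg_smul,
      add_neg_cancel_right]
  rw [h2] at h1
  rw [← h1.one_unique hU hA, smul_smul, ← exp_add]
  simp

theorem IsUnitaryGroup.expI_add_const_eq (hU : IsUnitaryGroup A U) (hA : IsEntire A) (c : ℝ) :
    expI (A + (c : ℂ) • LinearMap.id) = exp (I * c) • U 1 := by
  have hex : ∃ V : ℝ → (Fock H →L[ℂ] Fock H),
    IsUnitaryGroup (A + (c : ℂ) • LinearMap.id) V := ⟨_, hU.add_const c⟩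
  rw [expI, dif_pos hex]
  exact hU.one_eq_smul hA hex.choose_spec

theorem isUnitaryGroup_field (h : H) : IsUnitaryGroup (field h) (expCLM _ (isEntire_field h)) :=
  (isEntire_field h).isUnitaryGroup_expCLM (inner_field_left h)

/-- The Weyl operator `exp (i Φ(h))`. -/
abbrev weyl (h : H) : Fock H →L[ℂ] Fock H := expI (field h)

theorem weyl_eq (h : H) : weyl h = expCLM _ (isEntire_field h) 1 :=
  (isUnitaryGroup_field h).expI_eq (isEntire_field h)

theorem weyl_mem_unitary (h : H) : weyl h ∈ unitary (Fock H →L[ℂ] Fock H) := by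
  rw [weyl_eq]
  exact (isUnitaryGroup_field h).unitary_mem 1

theorem weyl_apply (h : H) (ψ : finiteParticle H) :
    weyl h (ψ : Fock H) = expVec (field h) I ψ := by
  rw [weyl_eq]
  exact (isUnitaryGroup_field h).one_apply (isEntire_field h) ψ

theorem expI_field_add_const (h : H) (c : ℝ) :
    expI (field h + (c : ℂ) • LinearMap.id) = exp (I * c) • weyl h := by
  rw [weyl_eq]
  exact (isUnitaryGroup_field h).expI_add_const_eq (isEntire_field h) c

theorem field_field_pow (h f : H) (k : ℕ) (ψ : finiteParticle H) :
    field h ((field f ^ k) ψ) = (field f ^ k) (field h ψ) +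
      ((k : ℂ) * ((⟪h, f⟫_ℂ - ⟪f, h⟫_ℂ) / 2)) • (field f ^ (k - 1)) ψ := by
  have hp : ∀ (j : ℕ) (φ : finiteParticle H),
      (field f ^ (j + 1)) φ = field f ((field f ^ j) φ) := fun j φ => by
    rw [pow_succ', Module.End.mul_apply]
  induction k with
  | zero => simp
  | succ k ih =>
    rw [hp, field_comm, ih, map_add, map_smul, hp, Nat.add_sub_cancel]
    rcases k with _ | k
    · simp
    · rw [Nat.add_sub_cancel, ← hp k ψ]
      push_cast
      module

/-- This places exp(iΦ(f))ψ in the domain of the closure of Φ(h): the partial sums converge, and so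
do their images under Φ(h). The extra term comes from the scalar commutator, via [Φ(h), Φ(f)ᵏ] = k
[Φ(h), Φ(f)] Φ(f)ᵏ⁻¹ and a shift of the index. -/
theorem hasSum_field_expVec (h f : H) (ψ : finiteParticle H) :
    HasSum (fun k : ℕ => (I ^ k / (k.factorial : ℂ)) •
        ((field h ((field f ^ k) ψ) : finiteParticle H) : Fock H))
      (expVec (field f) I (field h ψ) +
        (I * ((⟪h, f⟫_ℂ - ⟪f, h⟫_ℂ) / 2)) • expVec (field f) I ψ) := by
  have h1 := (isEntire_field f).hasSum_expVec I (field h ψ)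
  have h2 : HasSum (fun k : ℕ => (I ^ k / (k.factorial : ℂ)) •
      (((k : ℂ) * ((⟪h, f⟫_ℂ - ⟪f, h⟫_ℂ) / 2)) •
        (((field f ^ (k - 1)) ψ : finiteParticle H) : Fock H)))
      ((I * ((⟪h, f⟫_ℂ - ⟪f, h⟫_ℂ) / 2)) • expVec (field f) I ψ) := by
    rw [← hasSum_nat_add_iff' 1]
    simp only [Finset.sum_range_one, Nat.cast_zero, zero_mul, zero_smul, smul_zero, sub_zero]
    refine (((isEntire_field f).hasSum_expVec I ψ).const_smul _).congr_fun fun k => ?_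
    rw [Nat.add_sub_cancel, smul_smul, smul_smul]
    congr 1
    have h3 : ((k + 1 : ℕ) : ℂ) ≠ 0 := by exact_mod_cast k.succ_ne_zero
    have h4 : (k.factorial : ℂ) ≠ 0 := by exact_mod_cast k.factorial_ne_zero
    rw [Nat.factorial_succ, Nat.cast_mul, pow_succ]
    field_simp
  refine (h1.add h2).congr_fun fun k => ?_
  rw [field_field_pow, Submodule.coe_add, Submodule.coe_smul, smul_add]

/-- The Weyl commutation relation. -/
theorem star_weyl_mul_weyl_mul_weyl (h f : H) :
    star (weyl f) * weyl h * weyl f = exp (I * ((-(⟪h, f⟫_ℂ).im : ℝ) : ℂ)) • weyl h := by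
  set c : ℝ := -(⟪h, f⟫_ℂ).im with hc
  have hcκ : I * ((⟪h, f⟫_ℂ - ⟪f, h⟫_ℂ) / 2) = (c : ℂ) := by
    rw [← inner_conj_symm f h, sub_conj, hc]
    push_cast
    linear_combination ((⟪h, f⟫_ℂ).im : ℂ) * I_mul_I
  obtain ⟨hD1, hD2⟩ := Unitary.mem_iff.1 (weyl_mem_unitary f)
  set U := expCLM _ (isEntire_field h)
  have hU : IsUnitaryGroup (field h) U := isUnitaryGroup_field h
  -- The vector exp(iΦ(f))ψ need not be a finite-particle vector; the derivative of its orbit is the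
  -- limit of those of the partial sums, uniformly in t.
  have hderiv : ∀ ψ : finiteParticle H, HasDerivAt (fun t => U t (weyl f (ψ : Fock H)))
      (I • weyl f (((field h + (c : ℂ) • LinearMap.id : finiteParticle H →ₗ[ℂ] finiteParticle H) ψ :
        finiteParticle H) : Fock H)) 0 := by
    intro ψ
    have hsum := (hasSum_field_expVec h f ψ).tendsto_sum_nat
    have key := hasDerivAt_apply_of_tendsto hU.norm_apply
      (e := fun N => ((∑ k ∈ Finset.range N, (I ^ k / (k.factorial : ℂ)) • (field f ^ k) ψ :
        finiteParticle H) : Fock H))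
      (a := fun N => ((field h (∑ k ∈ Finset.range N, (I ^ k / (k.factorial : ℂ)) •
        (field f ^ k) ψ) : finiteParticle H) : Fock H))
      (φ := weyl f (ψ : Fock H)) (χ := expVec (field f) I (field h ψ) +
        (I * ((⟪h, f⟫_ℂ - ⟪f, h⟫_ℂ) / 2)) • expVec (field f) I ψ) ?_ ?_ ?_ 0
    · refine key.congr_deriv ?_
      rw [hU.map_zero, one_apply_eq_self, LinearMap.add_apply, Submodule.coe_add, map_add,
        LinearMap.smul_apply, LinearMap.id_apply, Submodule.coe_smul, map_smul, weyl_apply,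
        weyl_apply, hcκ]
    · intro N t
      refine (hasDerivAt_group_apply hU.map_add (hU.hasDerivAt _) t).congr_deriv ?_
      rw [map_smul]
    · rw [weyl_apply]
      simp only [Submodule.coe_sum, Submodule.coe_smul]
      exact ((isEntire_field f).hasSum_expVec I ψ).tendsto_sum_nat
    · simpa only [map_sum, map_smul, Submodule.coe_sum, Submodule.coe_smul] using hsum
  -- The conjugated group has generator i(Φ(h) + c), so uniqueness identifies it at time 1.
  have hV : IsUnitaryGroup (field h + (c : ℂ) • LinearMap.id)
      fun t => star (weyl f) * U t * weyl f :=
    { unitary_mem := fun t => mul_mem (mul_mem (Unitary.star_mem (weyl_mem_unitary f))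
        (hU.unitary_mem t)) (weyl_mem_unitary f)
      map_zero := by rw [hU.map_zero, mul_one, hD1]
      map_add := fun s t => by
        calc star (weyl f) * U (s + t) * weyl f
            = star (weyl f) * U s * 1 * U t * weyl f := by rw [hU.map_add]; noncomm_ring
          _ = star (weyl f) * U s * weyl f * (star (weyl f) * U t * weyl f) := by
            rw [← hD2]; noncomm_ring
      continuous := fun ψ =>
        (star (weyl f)).continuous.comp (hU.continuous (weyl f ψ))
      hasDerivAt := fun ψ => by
        refine (((star (weyl f)).restrictScalars ℝ).hasFDerivAt.comp_hasDerivAt (0 : ℝ)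
          (hderiv ψ)).congr_deriv ?_
        change star (weyl f) (I • weyl f _) = _
        rw [map_smul, ← mul_apply_eq_comp, hD1, one_apply_eq_self] }
  rw [weyl_eq h]
  exact hU.one_eq_smul (isEntire_field h) hV

end WeylOperators

/-! ### The displaced vacuum is the coherent vector -/

section CoherentVectors

open Filter Topology

variable {H : Type} [NormedAddCommGroup H] [InnerProductSpace ℂ H]

theorem creation_smul (c : ℂ) (h : H) : creation (c • h) = c • creation h := by
  refine LinearMap.ext fun ψ => finiteParticle_ext fun n => ?_
  rw [LinearMap.smul_apply, finiteParticle_smul_apply]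
  rcases n with _ | n
  · exact (smul_zero c).symm
  · rw [creation_apply_succ, creation_apply_succ, creationStep_smul]
    rfl

theorem annihilation_smul (c : ℂ) (h : H) :
    annihilation (c • h) = (starRingEnd ℂ) c • annihilation h := by
  refine LinearMap.ext fun ψ => finiteParticle_ext fun n => ?_
  rw [LinearMap.smul_apply, finiteParticle_smul_apply, annihilation_apply, annihilation_apply,
    creationStep_smul, map_smulₛₗ]
  rfl

/-- The field operator that generates the displacement of the vacuum to `Ω_J`. -/
theorem I_smul_field_displacement (J : H) (ψ : finiteParticle H) :
    I • field (-(I * (Real.sqrt 2 : ℝ)) • J) ψ = creation J ψ - annihilation J ψ := by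
  have h2 : ((Real.sqrt 2 : ℝ) : ℂ)⁻¹ * ((Real.sqrt 2 : ℝ) : ℂ) = 1 :=
    inv_mul_cancel₀ (ofReal_ne_zero.2 (by positivity))
  rw [field_apply, creation_smul, annihilation_smul, LinearMap.smul_apply, LinearMap.smul_apply,
    map_neg, map_mul, conj_I, conj_ofReal, ofReal_inv]
  match_scalars
  · linear_combination (-I * I) * h2 - I_mul_I
  · linear_combination (I * I) * h2 + I_mul_I

theorem annihilation_vacuum (h : H) : annihilation h (vacuum H) = 0 :=
  finiteParticle_ext fun n => map_zero (ContinuousLinearMap.adjoint (creationStep n h))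

theorem atMost_vacuum : AtMost 0 (vacuum H) := by
  rintro (_ | n) hn
  · exact absurd hn (lt_irrefl 0)
  · rfl

/-- The vector `(1 / k!) a*(J)ᵏ Ω₀`. -/
def coherentTerm (J : H) (k : ℕ) : finiteParticle H :=
  ((k.factorial : ℂ)⁻¹) • ((creation J) ^ k) (vacuum H)

theorem creation_coherentTerm (J : H) (k : ℕ) :
    creation J (coherentTerm J k) = ((k : ℂ) + 1) • coherentTerm J (k + 1) := by
  rw [coherentTerm, coherentTerm, map_smul, smul_smul, pow_succ', Module.End.mul_apply]
  congr 1
  have h1 : (k : ℂ) + 1 ≠ 0 := by exact_mod_cast k.succ_ne_zero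
  have h2 : (k.factorial : ℂ) ≠ 0 := by exact_mod_cast k.factorial_ne_zero
  rw [Nat.factorial_succ, Nat.cast_mul, Nat.cast_succ]
  field_simp

theorem annihilation_coherentTerm_zero (J : H) : annihilation J (coherentTerm J 0) = 0 := by
  rw [coherentTerm, map_smul, pow_zero, Module.End.one_apply, annihilation_vacuum, smul_zero]

/-- In terms of the formal series exp(t a*(J))Ω₀: annihilation multiplies it by t‖J‖². The induction
uses the commutation relation and then cancels the factor by which `creation_coherentTerm` raises
the index. -/
theorem annihilation_coherentTerm_succ (J : H) (k : ℕ) :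
    annihilation J (coherentTerm J (k + 1)) = ⟪J, J⟫_ℂ • coherentTerm J k := by
  induction k with
  | zero =>
    have h1 := annihilation_creation J J (coherentTerm J 0)
    simpa only [creation_coherentTerm, annihilation_coherentTerm_zero, map_zero, zero_add,
      Nat.cast_zero, one_smul] using h1
  | succ k ih =>
    have h1 := annihilation_creation J J (coherentTerm J (k + 1))
    rw [creation_coherentTerm, ih, map_smul, map_smul, creation_coherentTerm] at h1
    have h2 : ((k + 1 : ℕ) : ℂ) + 1 ≠ 0 := by exact_mod_cast (k + 1).succ_ne_zero
    refine smul_right_injective _ h2 ?_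
    simp only
    rw [h1]
    push_cast
    module

theorem creation_pow_vacuum_bound (J : H) (k : ℕ) :
    AtMost (0 + k) (((creation J) ^ k) (vacuum H)) ∧ ‖((creation J) ^ k) (vacuum H)‖ ≤
      (∏ j ∈ Finset.range k, (‖J‖ * Real.sqrt ((0 + j : ℕ) + 1))) * ‖vacuum H‖ := by
  induction k with
  | zero => exact ⟨atMost_vacuum, by simp⟩
  | succ k ih =>
    rw [pow_succ', Module.End.mul_apply]
    refine ⟨ih.1.creation J, (ih.1.norm_creation_le J).trans ?_⟩
    rw [Finset.prod_range_succ, mul_comm (∏ j ∈ _, _), mul_assoc (‖J‖ * _), mul_comm ‖J‖]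
    exact mul_le_mul_of_nonneg_left ih.2 (by positivity)

theorem summable_pow_mul_norm_coherentTerm (J : H) (r : ℝ) :
    Summable fun k => r ^ k * ‖coherentTerm J k‖ := by
  refine Summable.of_norm_bounded
    ((summable_pow_div_factorial_mul_prod_sqrt |r| ‖J‖ (norm_nonneg _) 0).mul_right ‖vacuum H‖)
    fun k => ?_
  rw [coherentTerm, norm_smul, norm_mul, norm_mul, norm_norm, norm_norm, norm_inv, norm_pow,
    Complex.norm_natCast, Real.norm_eq_abs, ← mul_assoc, ← div_eq_mul_inv, mul_assoc _ _ ‖vacuum H‖]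
  gcongr
  exact (creation_pow_vacuum_bound J k).2

theorem hasSum_coherentTerm (J : H) :
    HasSum (fun k => (((Real.exp (-(1 / 2) * ‖J‖ ^ 2) : ℝ) : ℂ)) • (coherentTerm J k : Fock H))
      (coherentVector J) := by
  refine HasSum.const_smul _ (Summable.hasSum (Summable.of_norm ?_))
  have := summable_pow_mul_norm_coherentTerm J 1
  simp only [one_pow, one_mul] at this
  exact this

/-- The displacement operator maps the vacuum to the coherent vector. -/
theorem weyl_displacement_vacuum (J : H) :
    weyl (-(I * (Real.sqrt 2 : ℝ)) • J) (vacuum H : Fock H) = coherentVector J := by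
  set f : H := -(I * (Real.sqrt 2 : ℝ)) • J with hf
  have hU := isUnitaryGroup_field f
  set U := expCLM _ (isEntire_field f)
  set q : ℂ := ⟪J, J⟫_ℂ with hq
  have hqJ : q = ((‖J‖ ^ 2 : ℝ) : ℂ) := by
    rw [hq, inner_self_eq_norm_sq_to_K]
    push_cast
    rfl
  -- The curve exp(-qt²/2) exp(ta*(J))Ω₀ solves g' = (a*(J) - a(J))g formally: the derivative of the
  -- Gaussian supplies the annihilation part, that of the series the creation part.
  let G : ℝ → ℂ := fun t => exp (-(1 / 2) * q * t ^ 2)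
  have hG : ∀ t : ℝ, HasDerivAt G (-(q * t) * G t) t := by
    intro t
    have h1 := (((((hasDerivAt_id t).ofReal_comp).fun_pow 2).const_mul (-(1 / 2) * q))).cexp
    refine h1.congr_deriv ?_
    simp only [G, id]
    push_cast
    ring
  have hc : ∀ (k : ℕ) (s : ℝ), HasDerivAt (fun t : ℝ => G t * (t : ℂ) ^ k)
      (-(q * s) * G s * (s : ℂ) ^ k + G s * ((k : ℂ) * (s : ℂ) ^ (k - 1))) s := by
    intro k s
    have h1 := ((hasDerivAt_id s).ofReal_comp).fun_pow k
    refine ((hG s).fun_mul h1).congr_deriv ?_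
    simp
  -- Truncation at N leaves two unmatched terms: the Gaussian derivative at k = N and the creation
  -- term leading to N + 1.
  have hsum : ∀ (s : ℝ) (N : ℕ), ∑ k ∈ Finset.range (N + 1),
      ((-(q * s) * G s * (s : ℂ) ^ k + G s * ((k : ℂ) * (s : ℂ) ^ (k - 1))) • coherentTerm J k -
        (G s * (s : ℂ) ^ k * I) • field f (coherentTerm J k)) =
      -((G s * (s : ℂ) ^ N) • ((q * s) • coherentTerm J N +
        ((N : ℂ) + 1) • coherentTerm J (N + 1))) := by
    intro s N
    induction N with
    | zero =>
      rw [Finset.sum_range_one, mul_smul _ I, hf, I_smul_field_displacement, creation_coherentTerm,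
        annihilation_coherentTerm_zero]
      simp only [Nat.cast_zero, zero_mul, pow_zero, sub_zero]
      module
    | succ N ih =>
      rw [Finset.sum_range_succ, ih, mul_smul _ I, hf, I_smul_field_displacement,
        creation_coherentTerm, annihilation_coherentTerm_succ, Nat.add_sub_cancel, ← hq]
      push_cast
      module
  have hbound : ∀ N : ℕ, ‖∑ k ∈ Finset.range (N + 1),
      (G 1 * ((1 : ℝ) : ℂ) ^ k) • (coherentTerm J k : Fock H) - U 1 (vacuum H : Fock H)‖ ≤
        ‖q‖ * ‖coherentTerm J N‖ + ((N : ℝ) + 1) * ‖coherentTerm J (N + 1)‖ := by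
    intro N
    have key := norm_sub_group_apply_le (A := field f) hU.norm_apply hU.map_zero hU.map_add
      hU.hasDerivAt hc (coherentTerm J) (N + 1)
      (ε := ‖q‖ * ‖coherentTerm J N‖ + ((N : ℝ) + 1) * ‖coherentTerm J (N + 1)‖) ?_
    · have h0 : ∑ k ∈ Finset.range (N + 1),
          (G 0 * ((0 : ℝ) : ℂ) ^ k) • (coherentTerm J k : Fock H) = vacuum H := by
        rw [Finset.sum_eq_single_of_mem 0 (by simp) (fun k _ hk => by simp [hk])]
        simp [G, coherentTerm]
      rwa [h0] at key
    · intro s hs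
      have h1 := congrArg (Subtype.val : finiteParticle H → Fock H) (hsum s N)
      have h2 : ‖G s * (s : ℂ) ^ N‖ ≤ 1 := by
        rw [norm_mul, norm_pow, norm_real, Real.norm_of_nonneg hs.1]
        refine mul_le_one₀ ?_ (by have := hs.1; positivity) (pow_le_one₀ hs.1 hs.2)
        simp only [G]
        rw [hqJ, show (-(1 / 2) * ((‖J‖ ^ 2 : ℝ) : ℂ) * (s : ℂ) ^ 2) =
          ((-(1 / 2) * ‖J‖ ^ 2 * s ^ 2 : ℝ) : ℂ) by push_cast; ring, norm_exp_ofReal,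
          Real.exp_le_one_iff]
        nlinarith [mul_nonneg (sq_nonneg ‖J‖) (sq_nonneg s)]
      have h3 : ‖(q * s) • coherentTerm J N + ((N : ℂ) + 1) • coherentTerm J (N + 1)‖ ≤
          ‖q‖ * ‖coherentTerm J N‖ + ((N : ℝ) + 1) * ‖coherentTerm J (N + 1)‖ := by
        refine (norm_add_le _ _).trans (add_le_add ?_ (le_of_eq ?_))
        · rw [norm_smul, norm_mul, norm_real, Real.norm_of_nonneg hs.1]
          gcongr
          exact mul_le_of_le_one_right (norm_nonneg _) hs.2
        · rw [norm_smul]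
          congr 1
          exact_mod_cast Complex.norm_natCast (N + 1)
      have h4 : ‖-((G s * (s : ℂ) ^ N) • ((q * s) • coherentTerm J N +
        ((N : ℂ) + 1) • coherentTerm J (N + 1)))‖ ≤
          ‖q‖ * ‖coherentTerm J N‖ + ((N : ℝ) + 1) * ‖coherentTerm J (N + 1)‖ := by
        rw [norm_neg, norm_smul]
        exact (mul_le_of_le_one_left (norm_nonneg _) h2).trans h3
      refine le_of_eq_of_le (congrArg norm (Eq.trans ?_ h1)) h4
      simp only [Submodule.coe_sum, Submodule.coe_sub, Submodule.coe_smul]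
  have hlim : Tendsto (fun N : ℕ => ‖q‖ * ‖coherentTerm J N‖ +
      ((N : ℝ) + 1) * ‖coherentTerm J (N + 1)‖) atTop (𝓝 0) := by
    have h1 := (summable_pow_mul_norm_coherentTerm J 1).tendsto_atTop_zero
    -- Radius 2 absorbs the factor N + 1 ≤ 2ᴺ⁺¹.
    have h2 := (tendsto_add_atTop_iff_nat 1).2
      (summable_pow_mul_norm_coherentTerm J 2).tendsto_atTop_zero
    simp only [one_pow, one_mul] at h1
    have h3 := (h1.const_mul ‖q‖).add h2
    rw [mul_zero, add_zero] at h3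
    refine squeeze_zero (fun N => by positivity) (fun N => ?_) h3
    gcongr
    exact_mod_cast (Nat.lt_two_pow_self (n := N + 1)).le
  have hG1 : G 1 = ((Real.exp (-(1 / 2) * ‖J‖ ^ 2) : ℝ) : ℂ) := by
    simp only [G]
    rw [hqJ, ofReal_exp]
    congr 1
    push_cast
    ring
  have h1 := (tendsto_add_atTop_iff_nat 1).2 (hasSum_coherentTerm J).tendsto_sum_nat
  have h2 : Tendsto (fun N => ∑ k ∈ Finset.range (N + 1),
      (((Real.exp (-(1 / 2) * ‖J‖ ^ 2) : ℝ) : ℂ)) • (coherentTerm J k : Fock H)) atTop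
      (𝓝 (U 1 (vacuum H : Fock H))) := by
    rw [tendsto_iff_norm_sub_tendsto_zero]
    refine squeeze_zero (fun _ => norm_nonneg _) (fun N => ?_) hlim
    simpa only [hG1, ofReal_one, one_pow, mul_one] using hbound N
  rw [weyl_eq]
  exact tendsto_nhds_unique h2 h1

end CoherentVectors

/-! ### The out automorphism and the out state -/

section OutAutomorphism

theorem fieldOf_out (x : ℝ → R3) (h : Photon) :
    fieldOf (creationOut x h) (annihilationOut x h) =
      field h + ((-(Real.sqrt 2 * (sourcePairing x h).re) : ℝ) : ℂ) • LinearMap.id := by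
  refine LinearMap.ext fun ψ => ?_
  have h1 : ((Real.sqrt 2 : ℝ) : ℂ)⁻¹ * 2 = ((Real.sqrt 2 : ℝ) : ℂ) := by
    have h2 : ((Real.sqrt 2 : ℝ) : ℂ) * ((Real.sqrt 2 : ℝ) : ℂ) = 2 := by
      rw [← ofReal_mul, Real.mul_self_sqrt (by norm_num)]
      norm_num
    have h3 : ((Real.sqrt 2 : ℝ) : ℂ) ≠ 0 := ofReal_ne_zero.2 (by positivity)
    rw [← h2]
    field_simp
  have h2 := add_conj (sourcePairing x h)
  simp only [fieldOf, creationOut, annihilationOut, field, LinearMap.add_apply,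
    LinearMap.smul_apply, LinearMap.sub_apply, LinearMap.id_apply, ofReal_inv, ofReal_neg,
    ofReal_mul]
  rw [ofReal_mul, ofReal_ofNat] at h2
  match_scalars
  all_goals first
    | ring1
    | linear_combination -((Real.sqrt 2 : ℝ) : ℂ)⁻¹ * h2 - ((sourcePairing x h).re : ℂ) * h1

theorem weylOut_eq (x : ℝ → R3) (h : Photon) :
    weylOut x h = exp (I * ((-(Real.sqrt 2 * (sourcePairing x h).re) : ℝ) : ℂ)) • weylIn h := by
  rw [weylOut, fieldOf_out, expI_field_add_const]
  rfl

theorem weylIn_mem_fieldAlgebra {h : Photon} (hh : h ∈ rapid) : weylIn h ∈ fieldAlgebra :=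
  StarSubalgebra.le_topologicalClosure _ (StarAlgebra.subset_adjoin ℂ _ ⟨h, hh, rfl⟩)

theorem isClosed_fieldAlgebra :
    IsClosed (fieldAlgebra : Set (Fock Photon →L[ℂ] Fock Photon)) :=
  StarSubalgebra.isClosed_topologicalClosure _

theorem fieldAlgebra_le {B : StarSubalgebra ℂ (Fock Photon →L[ℂ] Fock Photon)}
    (hB : IsClosed (B : Set (Fock Photon →L[ℂ] Fock Photon)))
    (h : ∀ h ∈ rapid, weylIn h ∈ B) : fieldAlgebra ≤ B :=
  StarSubalgebra.topologicalClosure_minimal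
    (StarAlgebra.adjoin_le (by rintro _ ⟨k, hk, rfl⟩; exact h k hk)) hB

/-- Conjugation with a unitary that maps every Weyl operator to a multiple of itself preserves the
field algebra. -/
theorem conj_mem_fieldAlgebra {D : Fock Photon →L[ℂ] Fock Photon} (hD : star D * D = 1)
    (hD' : D * star D = 1)
    (h : ∀ h ∈ rapid, ∃ z : ℂ, star D * weylIn h * D = z • weylIn h)
    {B : Fock Photon →L[ℂ] Fock Photon} (hB : B ∈ fieldAlgebra) :
    star D * B * D ∈ fieldAlgebra := by
  let γ : (Fock Photon →L[ℂ] Fock Photon) →⋆ₐ[ℂ] (Fock Photon →L[ℂ] Fock Photon) :=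
    { toFun := fun B => star D * B * D
      map_one' := by rw [mul_one, hD]
      map_mul' := fun B C => by
        calc star D * (B * C) * D = star D * B * 1 * C * D := by noncomm_ring
          _ = star D * B * D * (star D * C * D) := by rw [← hD']; noncomm_ring
      map_zero' := by rw [mul_zero, zero_mul]
      map_add' := fun B C => by rw [mul_add, add_mul]
      commutes' := fun z => by
        rw [Algebra.algebraMap_eq_smul_one, mul_smul_comm, smul_mul_assoc, mul_one, hD]
      map_star' := fun B => by rw [star_mul, star_mul, star_star, mul_assoc] }
  have hγ : Continuous γ := by
    change Continuous fun B : Fock Photon →L[ℂ] Fock Photon => star D * B * D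
    fun_prop
  -- The preimage of the algebra under conjugation is a closed *-subalgebra containing the
  -- generators.
  have hle : fieldAlgebra ≤ fieldAlgebra.comap γ := by
    refine fieldAlgebra_le (isClosed_fieldAlgebra.preimage hγ) fun k hk => ?_
    obtain ⟨z, hz⟩ := h k hk
    change star D * weylIn k * D ∈ fieldAlgebra
    rw [hz]
    exact fieldAlgebra.smul_mem (weylIn_mem_fieldAlgebra hk) z
  exact hle hB

/-- Conjugation with a unitary, restricted to the field algebra. -/
def conjFieldAlgebra (D : Fock Photon →L[ℂ] Fock Photon) (hD : star D * D = 1)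
    (hD' : D * star D = 1)
    (h : ∀ B ∈ fieldAlgebra, star D * B * D ∈ fieldAlgebra)
    (h' : ∀ B ∈ fieldAlgebra, D * B * star D ∈ fieldAlgebra) :
    fieldAlgebra ≃⋆ₐ[ℂ] fieldAlgebra where
  toFun B := ⟨star D * B * D, h B B.2⟩
  invFun B := ⟨D * B * star D, h' B B.2⟩
  left_inv B := by
    refine Subtype.ext ?_
    calc D * (star D * B * D) * star D = (D * star D) * B * (D * star D) := by noncomm_ring
      _ = B := by rw [hD', one_mul, mul_one]
  right_inv B := by
    refine Subtype.ext ?_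
    calc star D * (D * B * star D) * D = (star D * D) * B * (star D * D) := by noncomm_ring
      _ = B := by rw [hD, one_mul, mul_one]
  map_mul' B C := by
    refine Subtype.ext ?_
    calc star D * (B * C : Fock Photon →L[ℂ] Fock Photon) * D
        = star D * B * 1 * C * D := by noncomm_ring
      _ = star D * B * D * (star D * C * D) := by rw [← hD']; noncomm_ring
  map_add' B C := Subtype.ext (by
    change star D * (B + C : Fock Photon →L[ℂ] Fock Photon) * D = _
    rw [mul_add, add_mul]; rfl)
  map_star' B := Subtype.ext (by
    change star D * star (B : Fock Photon →L[ℂ] Fock Photon) * D = star (star D * B * D)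
    rw [star_mul, star_mul, star_star, mul_assoc])
  map_smul' z B := Subtype.ext (by
    change star D * (z • (B : Fock Photon →L[ℂ] Fock Photon)) * D = z • (star D * B * D)
    rw [mul_smul_comm, smul_mul_assoc])

/-- A norm closed *-subalgebra is a C*-algebra, and *-homomorphisms of C*-algebras are contractions.
-/
theorem continuous_starAlgEquiv_fieldAlgebra (β : fieldAlgebra ≃⋆ₐ[ℂ] fieldAlgebra) :
    Continuous β := by
  have : IsClosed (fieldAlgebra : Set (Fock Photon →L[ℂ] Fock Photon)) := isClosed_fieldAlgebra
  exact AddMonoidHomClass.continuous_of_bound β 1 fun B => by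
    rw [one_mul]
    exact NonUnitalStarAlgHom.norm_apply_le β B

theorem IsOutAutomorphism.apply_weylIn {x : ℝ → R3} {β : fieldAlgebra ≃⋆ₐ[ℂ] fieldAlgebra}
    (hβ : IsOutAutomorphism x β) {h : Photon} (hh : h ∈ rapid) :
    β ⟨weylIn h, weylIn_mem_fieldAlgebra hh⟩ =
      exp (I * ((Real.sqrt 2 * (sourcePairing x h).re : ℝ) : ℂ)) •
        ⟨weylIn h, weylIn_mem_fieldAlgebra hh⟩ := by
  obtain ⟨hW, hβh⟩ := hβ h hh
  have h1 : (⟨weylIn h, weylIn_mem_fieldAlgebra hh⟩ : fieldAlgebra) =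
      exp (I * ((Real.sqrt 2 * (sourcePairing x h).re : ℝ) : ℂ)) • ⟨weylOut x h, hW⟩ := by
    refine Subtype.ext ?_
    change weylIn h = _ • weylOut x h
    rw [weylOut_eq, smul_smul, ← exp_add, ← mul_add, ← ofReal_add, add_neg_cancel, ofReal_zero,
      mul_zero, exp_zero, one_smul]
  rw [congrArg β h1, map_smul]
  congr 1
  exact Subtype.ext hβh

theorem IsOutAutomorphism.unique {x : ℝ → R3} {α β : fieldAlgebra ≃⋆ₐ[ℂ] fieldAlgebra}
    (hα : IsOutAutomorphism x α) (hβ : IsOutAutomorphism x β) : β = α := by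
  refine StarAlgHomClass.ext_topologicalClosure (continuous_starAlgEquiv_fieldAlgebra β)
    (continuous_starAlgEquiv_fieldAlgebra α) fun B => ?_
  induction B using StarAlgebra.adjoin_induction_subtype with
  | mem W hW =>
    obtain ⟨h, hh, rfl⟩ := hW
    exact (hβ.apply_weylIn hh).trans (hα.apply_weylIn hh).symm
  | algebraMap z => exact (AlgHomClass.commutes β z).trans (AlgHomClass.commutes α z).symm
  | add B C hB hC =>
    exact (map_add β _ _).trans ((congrArg₂ (· + ·) hB hC).trans (map_add α _ _).symm)
  | mul B C hB hC =>
    exact (map_mul β _ _).trans ((congrArg₂ (· * ·) hB hC).trans (map_mul α _ _).symm)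
  | star B hB =>
    let B' : fieldAlgebra :=
      StarSubalgebra.inclusion (StarSubalgebra.le_topologicalClosure _) B
    have h1 : β (star B') = star (β B') := map_star β B'
    have h2 : α (star B') = star (α B') := map_star α B'
    exact h1.trans ((congrArg star hB).trans h2.symm)

/-- If the pairing with the source is the inner product with a one photon state `J`, then the out
automorphism exists and the out state is given by the coherent vector of `J`. -/
theorem exists_outAutomorphism {x : ℝ → R3} {J : Photon}
    (hJ : ∀ h : Photon, sourcePairing x h = ⟪J, h⟫_ℂ) :
    ∃ α : fieldAlgebra ≃⋆ₐ[ℂ] fieldAlgebra, IsOutAutomorphism x α ∧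
      ∀ B : fieldAlgebra, stateComp α B =
        vectorState (coherentVector J) (B : Fock Photon →L[ℂ] Fock Photon) := by
  set D : Fock Photon →L[ℂ] Fock Photon := weyl (-(I * (Real.sqrt 2 : ℝ)) • J) with hDdef
  obtain ⟨hD, hD'⟩ := Unitary.mem_iff.1 (weyl_mem_unitary (-(I * (Real.sqrt 2 : ℝ)) • J))
  rw [← hDdef] at hD hD'
  have hconj : ∀ h : Photon, star D * weylIn h * D =
      exp (I * ((Real.sqrt 2 * (sourcePairing x h).re : ℝ) : ℂ)) • weylIn h := by
    intro h
    refine (star_weyl_mul_weyl_mul_weyl h _).trans ?_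
    -- For f = -i√2 J one has -Im (h, f) = √2 Re (J, h), the opposite of the phase in `weylOut_eq`.
    rw [hJ, inner_smul_right, ← inner_conj_symm h J]
    congr 4
    simp [-inner_conj_symm]
  have hconj' : ∀ h : Photon, D * weylIn h * star D =
      exp (-(I * ((Real.sqrt 2 * (sourcePairing x h).re : ℝ) : ℂ))) • weylIn h := by
    intro h
    have h1 : weylIn h = exp (-(I * ((Real.sqrt 2 * (sourcePairing x h).re : ℝ) : ℂ))) •
        (star D * weylIn h * D) := by
      rw [hconj, smul_smul, ← exp_add, neg_add_cancel, exp_zero, one_smul]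
    calc D * weylIn h * star D
        = exp (-(I * ((Real.sqrt 2 * (sourcePairing x h).re : ℝ) : ℂ))) •
          ((D * star D) * weylIn h * (D * star D)) := by
          conv_lhs => rw [h1]
          rw [mul_smul_comm, smul_mul_assoc]
          noncomm_ring
      _ = _ := by rw [hD', one_mul, mul_one]
  let α := conjFieldAlgebra D hD hD'
    (fun B hB => conj_mem_fieldAlgebra hD hD' (fun h _ => ⟨_, hconj h⟩) hB)
    (fun B hB => by
      have := conj_mem_fieldAlgebra (D := star D) (by rw [star_star, hD']) (by rw [star_star, hD])
        (fun h _ => ⟨_, by rw [star_star]; exact hconj' h⟩) hB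
      rwa [star_star] at this)
  refine ⟨α, fun h hh => ?_, fun B => ?_⟩
  · have hW : weylOut x h ∈ fieldAlgebra := by
      rw [weylOut_eq]
      exact fieldAlgebra.smul_mem (weylIn_mem_fieldAlgebra hh) _
    refine ⟨hW, ?_⟩
    change star D * weylOut x h * D = weylIn h
    rw [weylOut_eq, mul_smul_comm, smul_mul_assoc, hconj, smul_smul, ← exp_add, ← mul_add,
      ← ofReal_add, neg_add_cancel, ofReal_zero, mul_zero, exp_zero, one_smul]
  · change ⟪(vacuum Photon : Fock Photon),
      (star D * (B : Fock Photon →L[ℂ] Fock Photon) * D) (vacuum Photon : Fock Photon)⟫_ℂ = _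
    rw [mul_assoc, mul_apply_eq_comp, ContinuousLinearMap.star_eq_adjoint,
      ContinuousLinearMap.adjoint_inner_right, mul_apply_eq_comp, hDdef, weyl_displacement_vacuum]
    rfl

end OutAutomorphism

/-! ### Decay and square integrability of the transverse source -/

section Source

theorem rdot_eq_inner (p : R3) (w : C3) : rdot p w = ⟪toC3 p, w⟫_ℂ := by
  simp [rdot, toC3, PiLp.inner_apply, mul_comm]

theorem norm_toC3 (v : R3) : ‖toC3 v‖ = ‖v‖ := by
  rw [EuclideanSpace.norm_eq, EuclideanSpace.norm_eq]
  simp [toC3]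

theorem toC3_add (v w : R3) : toC3 (v + w) = toC3 v + toC3 w := by
  ext k
  simp [toC3]

theorem toC3_smul (c : ℝ) (v : R3) : toC3 (c • v) = (c : ℂ) • toC3 v := by
  ext k
  simp [toC3]

/-- The inclusion of real in complex vectors as a bounded real linear map. -/
def toC3L : R3 →L[ℝ] C3 :=
  LinearMap.mkContinuous
    { toFun := toC3
      map_add' := toC3_add
      map_smul' := fun c v => by rw [toC3_smul, RingHom.id_apply, coe_smul] }
    1 fun v => by rw [one_mul]; exact (norm_toC3 v).le

theorem continuous_toC3 : Continuous toC3 := toC3L.continuous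

theorem hasDerivAt_toC3 {f : ℝ → R3} {f' : R3} {s : ℝ} (hf : HasDerivAt f f' s) :
    HasDerivAt (fun s => toC3 (f s)) (toC3 f') s :=
  toC3L.hasFDerivAt.comp_hasDerivAt s hf

theorem rdot_transverse (p : R3) (w : C3) : rdot p (transverse p w) = 0 := by
  rw [transverse, rdot_eq_inner, rdot_eq_inner, inner_sub_right, inner_smul_right,
    inner_self_eq_norm_sq_to_K, norm_toC3]
  -- At p = 0 the quotient in `transverse` is 0 by convention, and the product with p vanishes
  -- anyway.
  rcases eq_or_ne p 0 with rfl | hp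
  · have : toC3 0 = 0 := norm_eq_zero.1 (by rw [norm_toC3, norm_zero])
    simp [this]
  · have : ((‖p‖ : ℝ) : ℂ) ≠ 0 := ofReal_ne_zero.2 (norm_ne_zero_iff.2 hp)
    push_cast
    field_simp
    simp

theorem norm_transverse_le (p : R3) (w : C3) : ‖transverse p w‖ ≤ 2 * ‖w‖ := by
  have h1 : ‖(rdot p w / ((‖p‖ ^ 2 : ℝ) : ℂ)) • toC3 p‖ ≤ ‖w‖ := by
    rw [norm_smul, norm_div, norm_real, norm_toC3, Real.norm_of_nonneg (sq_nonneg _), rdot_eq_inner]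
    rcases eq_or_ne p 0 with rfl | hp
    · simp
    · have hp' : 0 < ‖p‖ := norm_pos_iff.2 hp
      have h2 := norm_inner_le_norm (𝕜 := ℂ) (toC3 p) w
      rw [norm_toC3] at h2
      rw [div_mul_eq_mul_div, div_le_iff₀ (by positivity)]
      nlinarith
  calc ‖transverse p w‖ ≤ ‖w‖ + ‖(rdot p w / ((‖p‖ ^ 2 : ℝ) : ℂ)) • toC3 p‖ := norm_sub_le _ _
    _ ≤ 2 * ‖w‖ := by linarith

theorem measurable_transverse {f : R3 → C3} (hf : Measurable f) :
    Measurable fun p => transverse p (f p) := by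
  have h1 : Measurable toC3 := continuous_toC3.measurable
  have h2 : Measurable fun p => rdot p (f p) := by
    simp only [rdot_eq_inner]
    exact h1.inner hf
  unfold transverse
  refine hf.sub (Measurable.smul (h2.div ?_) h1)
  fun_prop

variable {x : ℝ → R3} {v₀ : ℝ}

theorem norm_phase_smul (t : ℝ) (w : C3) : ‖exp (I * (t : ℂ)) • w‖ = ‖w‖ := by
  rw [norm_smul, mul_comm I, norm_exp_ofReal_mul_I, one_mul]

/-- Serves the measurability of J_T; the transverse projection itself may be discontinuous at p = 0.
-/
theorem continuous_sourceJ (hx : ContDiff ℝ 3 x) (hsupp : HasCompactSupport (deriv x)) :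
    Continuous (sourceJ x) := by
  have ha : Continuous (deriv x) := hx.continuous_deriv (by norm_num)
  have hxc : Continuous x := hx.continuous
  have hT := continuous_toC3
  have h : Continuous fun p : R3 =>
      ∫ s : ℝ, exp (I * ((‖p‖ * s - ⟪p, x s⟫_ℝ : ℝ) : ℂ)) • toC3 (deriv x s) := by
    refine continuous_of_dominated (bound := fun s => ‖deriv x s‖)
      (fun p => ?_) (fun p => ?_) ?_ (Filter.Eventually.of_forall fun s => ?_)
    · exact Continuous.aestronglyMeasurable (by fun_prop)
    · exact Filter.Eventually.of_forall fun s => by rw [norm_phase_smul, norm_toC3]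
    · exact (ha.integrable_of_hasCompactSupport hsupp).norm
    · fun_prop
  exact Continuous.const_smul h (-I * (((2 * Real.pi) ^ (-(3 / 2 : ℝ)) : ℝ) : ℂ))

theorem norm_integral_phase_le (p : R3) :
    ‖∫ s : ℝ, exp (I * ((‖p‖ * s - ⟪p, x s⟫_ℝ : ℝ) : ℂ)) • toC3 (deriv x s)‖ ≤
      ∫ s, ‖deriv x s‖ := by
  refine (norm_integral_le_integral_norm _).trans (le_of_eq ?_)
  simp only [norm_phase_smul, norm_toC3]

/-- Here i stands for the inverse of the phase derivative and d for (1 - v₀)⁻¹. With the prefactor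
‖p‖², each power of i is matched by a factor ‖p‖, so the bound is uniform in p. -/
theorem norm_sq_mul_norm_parts_le (p a a1 a2 : R3) {i d : ℝ} (hi0 : 0 ≤ i) (hid : ‖p‖ * i ≤ d) :
    ‖p‖ ^ 2 * ‖i ^ 2 • a2 + (3 * ⟪p, a1⟫_ℝ * i ^ 3) • a1 +
        (⟪p, a2⟫_ℝ * i ^ 3 + 3 * ⟪p, a1⟫_ℝ ^ 2 * i ^ 4) • a‖ ≤
      d ^ 2 * ‖a2‖ + 3 * d ^ 3 * ‖a1‖ ^ 2 + (d ^ 3 * ‖a2‖ + 3 * d ^ 4 * ‖a1‖ ^ 2) * ‖a‖ := by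
  have hin : 0 ≤ ‖p‖ * i := by positivity
  have hb1 : |⟪p, a1⟫_ℝ| ≤ ‖p‖ * ‖a1‖ := abs_real_inner_le_norm _ _
  have hb2 : |⟪p, a2⟫_ℝ| ≤ ‖p‖ * ‖a2‖ := abs_real_inner_le_norm _ _
  have hstep : ‖i ^ 2 • a2 + (3 * ⟪p, a1⟫_ℝ * i ^ 3) • a1 +
        (⟪p, a2⟫_ℝ * i ^ 3 + 3 * ⟪p, a1⟫_ℝ ^ 2 * i ^ 4) • a‖ ≤
      i ^ 2 * ‖a2‖ + (3 * (‖p‖ * ‖a1‖) * i ^ 3) * ‖a1‖ +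
        ((‖p‖ * ‖a2‖) * i ^ 3 + 3 * (‖p‖ * ‖a1‖) ^ 2 * i ^ 4) * ‖a‖ := by
    refine (norm_add₃_le).trans ?_
    rw [norm_smul, norm_smul, norm_smul]
    gcongr
    · rw [Real.norm_of_nonneg (by positivity)]
    · rw [Real.norm_eq_abs, abs_mul, abs_mul, abs_of_nonneg (a := (3 : ℝ)) (by norm_num),
        abs_of_nonneg (a := i ^ 3) (by positivity)]
      gcongr
    · rw [Real.norm_eq_abs]
      refine (abs_add_le _ _).trans ?_
      rw [abs_mul, abs_mul, abs_mul, abs_pow, abs_pow, abs_pow, abs_of_nonneg hi0,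
        abs_of_nonneg (a := (3 : ℝ)) (by norm_num)]
      gcongr
  calc _ ≤ ‖p‖ ^ 2 * (i ^ 2 * ‖a2‖ + (3 * (‖p‖ * ‖a1‖) * i ^ 3) * ‖a1‖ +
        ((‖p‖ * ‖a2‖) * i ^ 3 + 3 * (‖p‖ * ‖a1‖) ^ 2 * i ^ 4) * ‖a‖) := by gcongr
    _ = (‖p‖ * i) ^ 2 * ‖a2‖ + 3 * (‖p‖ * i) ^ 3 * ‖a1‖ ^ 2 +
          ((‖p‖ * i) ^ 3 * ‖a2‖ + 3 * (‖p‖ * i) ^ 4 * ‖a1‖ ^ 2) * ‖a‖ := by ring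
    _ ≤ _ := by gcongr

theorem hasCompactSupport_fun_smul {K F : Type*} [Zero F] [SMulZeroClass K F] (c : ℝ → K)
    {f : ℝ → F} (hf : HasCompactSupport f) : HasCompactSupport fun s => c s • f s :=
  hf.mono fun s hs h => hs (by simp only [h, smul_zero])

/-- Two integrations by parts in an oscillatory integral with phase `θ`. -/
theorem norm_integral_phase_smul_le {θ w : ℝ → ℝ} {a F1 F1' F2 F2' : ℝ → R3}
    (hθ : ∀ s, HasDerivAt θ (w s) s) (hF1 : ∀ s, HasDerivAt F1 (F1' s) s)
    (hF2 : ∀ s, HasDerivAt F2 (F2' s) s) (h1 : ∀ s, w s • F1 s = a s)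
    (h2 : ∀ s, w s • F2 s = F1' s) (hca : Continuous a) (hcF2' : Continuous F2')
    (hsa : HasCompactSupport a) (hsF1 : HasCompactSupport F1) (hsF2 : HasCompactSupport F2)
    (hsF2' : HasCompactSupport F2') :
    ‖∫ s, exp (I * (θ s : ℂ)) • toC3 (a s)‖ ≤ ∫ s, ‖F2' s‖ := by
  -- One primitive performs both integrations by parts: in the derivative of exp(iθ)(-iF1 + F2) the
  -- term iwF2 cancels -iF1', leaving a + F2'.
  have hE : ∀ s, HasDerivAt (fun s => exp (I * (θ s : ℂ)) • ((-I) • toC3 (F1 s) + toC3 (F2 s)))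
      (exp (I * (θ s : ℂ)) • toC3 (a s) + exp (I * (θ s : ℂ)) • toC3 (F2' s)) s := by
    intro s
    refine ((((hθ s).ofReal_comp.const_mul I).cexp).fun_smul
      (((hasDerivAt_toC3 (hF1 s)).fun_const_smul (-I)).fun_add
      (hasDerivAt_toC3 (hF2 s)))).congr_deriv ?_
    rw [← h1, ← h2, toC3_smul, toC3_smul]
    match_scalars
    all_goals first
      | ring1
      | linear_combination (-(w s : ℂ) * exp (I * (θ s : ℂ))) * I_mul_I
  have hcθ : Continuous θ := continuous_iff_continuousAt.2 fun s => (hθ s).continuousAt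
  have hcF1 : Continuous F1 := continuous_iff_continuousAt.2 fun s => (hF1 s).continuousAt
  have hcF2 : Continuous F2 := continuous_iff_continuousAt.2 fun s => (hF2 s).continuousAt
  have hcT := continuous_toC3
  have hT0 : toC3 0 = 0 := norm_eq_zero.1 (by rw [norm_toC3, norm_zero])
  have hi : ∀ {f : ℝ → C3}, Continuous f → HasCompactSupport f →
      Integrable fun s => exp (I * (θ s : ℂ)) • f s := fun hf hs =>
    Continuous.integrable_of_hasCompactSupport (by fun_prop) (hasCompactSupport_fun_smul _ hs)
  have hi1 := hi (hcT.comp hca) (hsa.comp_left hT0)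
  have hi2 := hi (hcT.comp hcF2') (hsF2'.comp_left hT0)
  have hi3 := hi (((hcT.comp hcF1).const_smul (-I)).add (hcT.comp hcF2))
    ((hasCompactSupport_fun_smul (fun _ => -I) (hsF1.comp_left hT0)).add
      (hsF2.comp_left hT0))
  have hzero := integral_eq_zero_of_hasDerivAt_of_integrable hE (hi1.add hi2) hi3
  have heq : ∫ s, exp (I * (θ s : ℂ)) • toC3 (a s) = -∫ s, exp (I * (θ s : ℂ)) • toC3 (F2' s) :=
    eq_neg_of_add_eq_zero_left ((integral_add hi1 hi2).symm.trans hzero)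
  rw [heq, norm_neg]
  refine (norm_integral_le_integral_norm _).trans (le_of_eq ?_)
  simp only [norm_phase_smul, norm_toC3]

/-- Two integrations by parts in the source integral. -/
theorem norm_sq_mul_norm_integral_phase_le (hx : ContDiff ℝ 3 x) (hv₀ : v₀ < 1)
    (hspeed : ∀ t, ‖deriv x t‖ ≤ v₀) (hsupp : HasCompactSupport (deriv x)) {p : R3} (hp : p ≠ 0) :
    ‖p‖ ^ 2 * ‖∫ s : ℝ, exp (I * ((‖p‖ * s - ⟪p, x s⟫_ℝ : ℝ) : ℂ)) • toC3 (deriv x s)‖ ≤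
      ∫ s, ((1 - v₀)⁻¹ ^ 2 * ‖deriv (deriv (deriv x)) s‖ +
        3 * (1 - v₀)⁻¹ ^ 3 * ‖deriv (deriv x) s‖ ^ 2 +
        ((1 - v₀)⁻¹ ^ 3 * ‖deriv (deriv (deriv x)) s‖ +
          3 * (1 - v₀)⁻¹ ^ 4 * ‖deriv (deriv x) s‖ ^ 2) * ‖deriv x s‖) := by
  have hp' : 0 < ‖p‖ := norm_pos_iff.2 hp
  have hδ : 0 < 1 - v₀ := by linarith
  set a := deriv x with ha
  set a1 := deriv a with ha1
  set a2 := deriv a1 with ha2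
  have hCa : ContDiff ℝ 2 a := ((contDiff_succ_iff_deriv (n := 2)).1 (by exact_mod_cast hx)).2.2
  have hCa1 : ContDiff ℝ 1 a1 :=
    ((contDiff_succ_iff_deriv (n := 1)).1 (by exact_mod_cast hCa)).2.2
  have hdx : ∀ s, HasDerivAt x (a s) s := fun s => (hx.differentiable (by norm_num) s).hasDerivAt
  have hda : ∀ s, HasDerivAt a (a1 s) s := fun s => (hCa.differentiable (by norm_num) s).hasDerivAt
  have hda1 : ∀ s, HasDerivAt a1 (a2 s) s :=
    fun s => (hCa1.differentiable (by norm_num) s).hasDerivAt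
  have hca : Continuous a := hCa.continuous
  have hca1 : Continuous a1 := hCa1.continuous
  have hca2 : Continuous a2 := hCa1.continuous_deriv (by norm_num)
  have hcx : Continuous x := hx.continuous
  have hs1 : HasCompactSupport a1 := hsupp.deriv
  have hs2 : HasCompactSupport a2 := hs1.deriv
  let w : ℝ → ℝ := fun s => ‖p‖ - ⟪p, a s⟫_ℝ
  let q1 : ℝ → ℝ := fun s => ⟪p, a1 s⟫_ℝ
  let q2 : ℝ → ℝ := fun s => ⟪p, a2 s⟫_ℝ
  -- Speed below that of light excludes stationary points of the phase.
  have hw : ∀ s, ‖p‖ * (1 - v₀) ≤ w s := by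
    intro s
    have h1 : ⟪p, a s⟫_ℝ ≤ ‖p‖ * v₀ :=
      (real_inner_le_norm _ _).trans (mul_le_mul_of_nonneg_left (hspeed s) hp'.le)
    simp only [w]
    linarith
  have hw0 : ∀ s, 0 < w s := fun s => (mul_pos hp' hδ).trans_le (hw s)
  have hwne : ∀ s, w s ≠ 0 := fun s => (hw0 s).ne'
  have hdw : ∀ s, HasDerivAt w (-q1 s) s := by
    intro s
    have h1 := ((hasDerivAt_const s p).inner ℝ (hda s)).const_sub ‖p‖
    simpa [q1] using h1
  have hdq : ∀ s, HasDerivAt q1 (q2 s) s := by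
    intro s
    have h1 := (hasDerivAt_const s p).inner ℝ (hda1 s)
    simpa [q1, q2] using h1
  have hdinv : ∀ s, HasDerivAt (fun s => (w s)⁻¹) (q1 s * (w s)⁻¹ ^ 2) s := by
    intro s
    refine ((hdw s).fun_inv (hwne s)).congr_deriv ?_
    field_simp
  -- F1 = a/w and F2 = F1'/w; the third derivative of x enters only through F2'.
  let F1 : ℝ → R3 := fun s => (w s)⁻¹ • a s
  let F1' : ℝ → R3 := fun s => (w s)⁻¹ • a1 s + (q1 s * (w s)⁻¹ ^ 2) • a s
  let F2 : ℝ → R3 := fun s => (w s)⁻¹ ^ 2 • a1 s + (q1 s * (w s)⁻¹ ^ 3) • a s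
  let F2' : ℝ → R3 := fun s => (w s)⁻¹ ^ 2 • a2 s + (3 * q1 s * (w s)⁻¹ ^ 3) • a1 s +
    (q2 s * (w s)⁻¹ ^ 3 + 3 * q1 s ^ 2 * (w s)⁻¹ ^ 4) • a s
  have hF1 : ∀ s, HasDerivAt F1 (F1' s) s := fun s => (hdinv s).fun_smul (hda s)
  have hF2 : ∀ s, HasDerivAt F2 (F2' s) s := by
    intro s
    refine ((((hdinv s).fun_pow 2).fun_smul (hda1 s)).fun_add
      (((hdq s).fun_mul ((hdinv s).fun_pow 3)).fun_smul (hda s))).congr_deriv ?_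
    simp only [F2']
    match_scalars <;> ring
  have hθ : ∀ s, HasDerivAt (fun s => ‖p‖ * s - ⟪p, x s⟫_ℝ) (w s) s := by
    intro s
    have := ((hasDerivAt_id s).const_mul ‖p‖).fun_sub ((hasDerivAt_const s p).inner ℝ (hdx s))
    simpa [w] using this
  have hcw : Continuous fun s => (w s)⁻¹ := by
    refine Continuous.inv₀ ?_ hwne
    simp only [w]
    fun_prop
  have hcq1 : Continuous q1 := by simp only [q1]; fun_prop
  have hcq2 : Continuous q2 := by simp only [q2]; fun_prop
  have hcF1 : Continuous F1 := by simp only [F1]; fun_prop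
  have hcF2 : Continuous F2 := by simp only [F2]; fun_prop
  have hcF2' : Continuous F2' := by simp only [F2']; fun_prop
  have hsF1 : HasCompactSupport F1 := hasCompactSupport_fun_smul _ hsupp
  have hsF2 : HasCompactSupport F2 :=
    (hasCompactSupport_fun_smul _ hs1).add (hasCompactSupport_fun_smul _ hsupp)
  have hsF2' : HasCompactSupport F2' :=
    ((hasCompactSupport_fun_smul _ hs2).add (hasCompactSupport_fun_smul _ hs1)).add
      (hasCompactSupport_fun_smul _ hsupp)
  have hnorm := norm_integral_phase_smul_le hθ hF1 hF2
    (fun s => by simp only [F1, smul_smul, mul_inv_cancel₀ (hwne s), one_smul])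
    (fun s => by
      have := mul_inv_cancel₀ (hwne s)
      simp only [F2, F1']
      match_scalars
      · linear_combination (w s)⁻¹ * this
      · linear_combination q1 s * (w s)⁻¹ ^ 2 * this)
    hca hcF2' hsupp hsF1 hsF2 hsF2'
  have hinvw : ∀ s, ‖p‖ * (w s)⁻¹ ≤ (1 - v₀)⁻¹ := by
    intro s
    rw [← div_eq_mul_inv, div_le_iff₀ (hw0 s), inv_mul_eq_div, le_div_iff₀ hδ]
    exact hw s
  refine (mul_le_mul_of_nonneg_left hnorm (sq_nonneg _)).trans ?_
  rw [← integral_const_mul]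
  refine integral_mono
    ((hcF2'.integrable_of_hasCompactSupport hsF2').norm.const_mul _) ?_ fun s => ?_
  · refine Continuous.integrable_of_hasCompactSupport (by fun_prop) ?_
    exact ((hs2.norm.mul_left).add (HasCompactSupport.mul_left (hs1.norm.comp_left (g := (· ^ 2))
      (by norm_num)))).add (HasCompactSupport.mul_left hsupp.norm)
  · exact norm_sq_mul_norm_parts_le p (a s) (a1 s) (a2 s) (inv_nonneg.2 (hw0 s).le) (hinvw s)

/-- The source is bounded by `C (1 + |p|²)⁻¹`. -/
theorem exists_norm_sourceJT_le (hx : ContDiff ℝ 3 x) (hv₀ : v₀ < 1)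
    (hspeed : ∀ t, ‖deriv x t‖ ≤ v₀) (hsupp : HasCompactSupport (deriv x)) :
    ∃ C, ∀ p, ‖sourceJT x p‖ ≤ C * (1 + ‖p‖ ^ 2)⁻¹ := by
  obtain ⟨K, hK⟩ : ∃ K, ∀ p : R3, p ≠ 0 → ‖p‖ ^ 2 *
      ‖∫ s : ℝ, exp (I * ((‖p‖ * s - ⟪p, x s⟫_ℝ : ℝ) : ℂ)) • toC3 (deriv x s)‖ ≤ K :=
    ⟨_, fun p hp => norm_sq_mul_norm_integral_phase_le hx hv₀ hspeed hsupp hp⟩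
  -- The 2 comes from `norm_transverse_le`; the integral bounds the source itself and K bounds |p|²
  -- times it. The maximum with 0 covers p = 0, where K says nothing.
  refine ⟨2 * (‖(-I * (((2 * Real.pi) ^ (-(3 / 2 : ℝ)) : ℝ) : ℂ))‖ *
    ((∫ s, ‖deriv x s‖) + max K 0)), fun p => ?_⟩
  refine (norm_transverse_le p _).trans ?_
  rw [sourceJ, norm_smul, mul_assoc 2, mul_assoc]
  gcongr
  rw [← div_eq_mul_inv, le_div_iff₀ (by positivity), mul_add, mul_one,
    mul_comm _ (‖p‖ ^ 2)]
  refine add_le_add (norm_integral_phase_le p) ?_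
  rcases eq_or_ne p 0 with rfl | hp
  · simp
  · exact (hK p hp).trans (le_max_left _ _)

/-- In polar coordinates the volume factor r² outweighs the singularity 1/(2r), leaving r/2 (1 +
r²)⁻², which is at most (1 + r²)⁻¹. Decay of order |p|⁻¹, from a single integration by parts, would
leave a logarithmic divergence at infinity. -/
theorem integrable_photonMeasure_of_decay :
    Integrable (fun p : R3 => ((1 + ‖p‖ ^ 2)⁻¹) ^ 2) photonMeasure := by
  rw [photonMeasure, integrable_withDensity_iff (by fun_prop)
    (Filter.Eventually.of_forall fun p => ENNReal.ofReal_lt_top)]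
  have h1 : ∀ p : R3, ((1 + ‖p‖ ^ 2)⁻¹) ^ 2 * (ENNReal.ofReal ((2 * ‖p‖)⁻¹)).toReal =
      (fun r : ℝ => ((1 + r ^ 2)⁻¹) ^ 2 * (2 * r)⁻¹) ‖p‖ := fun p => by
    rw [ENNReal.toReal_ofReal (by positivity)]
  simp only [h1]
  rw [integrable_fun_norm_addHaar volume (f := fun r : ℝ => ((1 + r ^ 2)⁻¹) ^ 2 * (2 * r)⁻¹)]
  refine Integrable.mono' (integrable_inv_one_add_sq.integrableOn (s := Set.Ioi 0)) ?_ ?_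
  · exact Measurable.aestronglyMeasurable (by fun_prop)
  · filter_upwards [ae_restrict_mem measurableSet_Ioi] with r hr
    have hr' : 0 < r := hr
    rw [finrank_euclideanSpace_fin, smul_eq_mul, Real.norm_of_nonneg (by positivity)]
    have h2 : r ^ (3 - 1) * (((1 + r ^ 2)⁻¹) ^ 2 * (2 * r)⁻¹) =
        (r / 2 * (1 + r ^ 2)⁻¹) * (1 + r ^ 2)⁻¹ := by
      field_simp
    rw [h2]
    refine mul_le_of_le_one_left (by positivity) ?_
    rw [← div_eq_mul_inv, div_le_one (by positivity)]
    nlinarith [sq_nonneg (r - 1)]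

theorem memLp_sourceJT (hx : ContDiff ℝ 3 x) (hv₀ : v₀ < 1)
    (hspeed : ∀ t, ‖deriv x t‖ ≤ v₀) (hsupp : HasCompactSupport (deriv x)) :
    MemLp (sourceJT x) 2 photonMeasure := by
  have hm : AEStronglyMeasurable (sourceJT x) photonMeasure :=
    (measurable_transverse (continuous_sourceJ hx hsupp).measurable).aestronglyMeasurable
  obtain ⟨C, hC⟩ := exists_norm_sourceJT_le hx hv₀ hspeed hsupp
  rw [memLp_two_iff_integrable_sq_norm hm]
  refine Integrable.mono' (integrable_photonMeasure_of_decay.const_mul (C ^ 2)) (hm.norm.pow 2)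
    (Filter.Eventually.of_forall fun p => ?_)
  rw [Real.norm_of_nonneg (sq_nonneg _), ← mul_pow]
  exact pow_le_pow_left₀ (norm_nonneg _) (hC p) 2

/-- A square integrable source defines a one photon state whose inner product with `h` is the
pairing of the source with `h`. -/
theorem exists_photon_of_memLp (h : MemLp (sourceJT x) 2 photonMeasure) :
    ∃ J : Photon, J.toFun =ᵐ[photonMeasure] sourceJT x ∧
      ∀ h : Photon, sourcePairing x h = ⟪J, h⟫_ℂ := by
  have hmem : h.toLp (sourceJT x) ∈ photonSpace := by
    change ∀ᵐ p ∂photonMeasure, rdot p (h.toLp (sourceJT x) p) = 0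
    filter_upwards [h.coeFn_toLp] with p hp
    rw [hp]
    exact rdot_transverse p _
  let J : Photon := (⟨h.toLp (sourceJT x), hmem⟩ : photonSpace)
  have hJ : J.toFun =ᵐ[photonMeasure] sourceJT x := h.coeFn_toLp
  refine ⟨J, hJ, fun k => ?_⟩
  have h1 : ⟪J, k⟫_ℂ = ∫ p, ⟪J.toFun p, k.toFun p⟫_ℂ ∂photonMeasure := L2.inner_def J.toLp k.toLp
  rw [h1]
  refine integral_congr_ae ?_
  filter_upwards [hJ] with p hp
  rw [hp]

end Source

end PointSource

end

theorem mainTheorem3 (x : ℝ → PointSource.R3) (v₀ : ℝ) (hv₀ : v₀ < 1)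
    (hx : ContDiff ℝ 3 x) (hspeed : ∀ t, ‖deriv x t‖ ≤ v₀)
    (hsupp : HasCompactSupport (deriv x)) :
    ∃ J : PointSource.Photon,
      J.toFun =ᵐ[PointSource.photonMeasure] PointSource.sourceJT x ∧
      ∃ α : PointSource.fieldAlgebra ≃⋆ₐ[ℂ] PointSource.fieldAlgebra,
        PointSource.IsOutAutomorphism x α ∧
        (∀ β : PointSource.fieldAlgebra ≃⋆ₐ[ℂ] PointSource.fieldAlgebra,
          PointSource.IsOutAutomorphism x β → β = α) ∧
        ∀ B : PointSource.fieldAlgebra,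
          PointSource.stateComp α B =
            PointSource.vectorState (PointSource.coherentVector J)
              (B : PointSource.Fock PointSource.Photon →L[ℂ]
                PointSource.Fock PointSource.Photon) := by
  obtain ⟨J, hJ, hpair⟩ := PointSource.exists_photon_of_memLp
    (PointSource.memLp_sourceJT hx hv₀ hspeed hsupp)
  obtain ⟨α, hα, hstate⟩ := PointSource.exists_outAutomorphism hpair
  exact ⟨J, hJ, α, hα, fun β hβ => hα.unique hβ, hstate⟩
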